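/- **Conventions.** Let $n\ge 2$. Give $x_1,\dots,x_n$ rational weights $w_i=\deg x_i>0$ with $w_1+\dots+w_n=n$, and put $\deg dx_i=w_i$. Let $\Lambda^j$ be the space of polynomial $j$-forms on $\mathbb C^n$, and $\Lambda^j[\lambda]$ the space of $j$-forms in $dx_1,\dots,dx_n$ with coefficients in $\mathbb C[x,\lambda]$; $d$ is always the exterior derivative in $x$ only. The norm $\|\cdot\|$ of a polynomial is the sum of the absolute values of its coefficients (in all its variables, including $\lambda$), the norm of a form is the sum of the norms of its coefficients. Degrees are quasihomogeneous degrees. Let $f\in\mathbb C[x]$ be quasihomogeneous of degree $r$ with an isolated critical point at $0$. A *monomial basis* is a tuple of monomial forms $\mu_i=x^{\alpha_i}dx_1\wedge\dots\wedge dx_n$, $i=1,\dots,l$, whose classes form a basis of $\Lambda^n/df\wedge\Lambda^{n-1}$. The *division modulus* $M=M(f)$ is the smallest $M$ for which there is a monomial basis such that every $\mu\in\Lambda^n$ can be written as $\mu=\sum c_i\mu_i+df\wedge\eta$ with $c_i\in\mathbb C$, $\eta\in\Lambda^{n-1}$, $\deg\eta\le\deg\mu-r$ and $\|\eta\|+\sum|c_i|\le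 M\|\mu\|$; a monomial basis having this property with $M=M(f)$ is called *optimal*. Let $f_s$ run over all monomials in $x$ (with coefficient $1$) of degree $<r$, and let $$F(x,\lambda)=f(x)+\sum_s\lambda_sf_s(x),\qquad \deg\lambda_s=r-\deg f_s,$$ be the general semiquasihomogeneous polynomial with principal part $f$; it is quasihomogeneous of degree $r$ in $(x,\lambda)$. **Theorem.** Optimal monomial bases exist. Let $\mu_1,\dots,\mu_l$ be any of them and let $\omega_1,\dots,\omega_l\in\Lambda^{n-1}$ be quasihomogeneous primitives, $d\omega_i=\mu_i$, $\deg\omega_i=\deg\mu_i$ (for instance monomial ones). Then every form $\omega\in\Lambda^{n-1}[\lambda]$ that is quasihomogeneous of degree $k$ in $(x,\lambda)$ can be represented as $$\omega=\sum_{i=1}^l p_i\,\omega_i+dF\wedge\xi+d\xi',$$ where $p_i\in\mathbb C[F,\lambda]$ is quasihomogeneous in $(F,\lambda)$, with $\deg F=r$, of degree $k-\deg\omega_i$, and $\xi,\xi'\in\Lambda^{n-2}[\lambda]$ are quasihomogeneous in $(x,\lambda)$ of degrees $k-r$ and $k$ respectively (a polynomial or form of negative degree being $0$). Moreover, the $p_i$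 can be chosen so that, with norms taken in $\mathbb C[F,\lambda]$, $$\sum_{i=1}^l\|p_i\|\le A(r,k)\,M(f)^{N(r,k)}\,\|\omega\|,$$ where the numbers $A(r,k)\in\mathbb R$ and $N(r,k)\in\mathbb N$ depend only on $r$, $k$, $n$ and the weights $w_1,\dots,w_n$ (not on $f$ or $\omega$), and, in the symmetric case $w_1=\dots=w_n=1$, $$\sum_{i=1}^l\|p_i\|\le k!\,r^{k(n+3)}\,M(f)^k\,\|\omega\|.$$ -/

import Mathlib

open MvPolynomial Filter Topology

noncomputable section

namespace PolyForms

/-- Polynomial differential forms (of all degrees) in the differentials `dx_0, …, dx_{n-1}`, with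
coefficients in `ℂ[τ]`. The value `ω s` is the coefficient of `dx_{i₁} ∧ ⋯ ∧ dx_{i_k}`, where
`i₁ < ⋯ < i_k` are the elements of `s`. The set `τ` of variables contains the space variables and
possibly additional parameters. -/
abbrev DForm (n : ℕ) (τ : Type) : Type := Finset (Fin n) → MvPolynomial τ ℂ

variable {n : ℕ} {τ : Type}

/-- The space of polynomial `k`-forms. -/
def forms (n : ℕ) (τ : Type) (k : ℕ) : Submodule ℂ (DForm n τ) where
  carrier := {ω | ∀ s : Finset (Fin n), s.card ≠ k → ω s = 0}
  add_mem' := by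
    intro a b ha hb s hs
    simp [ha s hs, hb s hs]
  zero_mem' := by
    intro s _
    rfl
  smul_mem' := by
    intro c a ha s hs
    simp [ha s hs]

/-- A polynomial as a `0`-form. -/
def ofFun (p : MvPolynomial τ ℂ) : DForm n τ := Pi.single ∅ p

/-- The number of pairs `(a, b) ∈ s × t` with `b < a`, so that
`dx_s ∧ dx_t = (-1) ^ inversions s t • dx_{s ∪ t}` for disjoint `s`, `t`. -/
def inversions (s t : Finset (Fin n)) : ℕ := ((s ×ˢ t).filter fun p => p.2 < p.1).card

/-- The exterior product. -/
def wedge (ω η : DForm n τ) : DForm n τ := fun u =>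
  ∑ s ∈ u.powerset, (-1) ^ inversions s (u \ s) * (ω s * η (u \ s))

/-- The exterior derivative with respect to the space variables `x 0, …, x (n-1)` only (all other
variables are regarded as parameters). -/
def extD (x : Fin n → τ) (ω : DForm n τ) : DForm n τ := fun u =>
  ∑ i ∈ u, (-1) ^ (u.filter fun j => j < i).card * pderiv (x i) (ω (u.erase i))

/-- The exterior product `η ↦ θ ∧ η` as a linear map. -/
def wedgeLeft (θ : DForm n τ) : DForm n τ →ₗ[ℂ] DForm n τ where
  toFun := wedge θ
  map_add' := by
    intro a b
    funext u
    simp only [wedge, Pi.add_apply, mul_add, Finset.sum_add_distrib]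
  map_smul' := by
    intro c a
    funext u
    simp only [wedge, Pi.smul_apply, mul_smul_comm, Finset.smul_sum, RingHom.id_apply]

/-- The norm of a polynomial: the sum of the absolute values of its coefficients. -/
def polyNorm (p : MvPolynomial τ ℂ) : ℝ := ∑ m ∈ p.support, ‖p.coeff m‖

/-- The norm of a form: the sum of the norms of its coefficients. -/
def formNorm (ω : DForm n τ) : ℝ := ∑ s : Finset (Fin n), polyNorm (ω s)

/-- The form `ω` is quasihomogeneous of degree `d` for the weights `v` of the variables, where
`deg dx_i = deg x_i`. -/
def IsQuasihomogeneous (v : τ → ℚ) (x : Fin n → τ) (ω : DForm n τ) (d : ℚ) : Prop :=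
  ∀ s : Finset (Fin n), IsWeightedHomogeneous v (ω s) (d - ∑ i ∈ s, v (x i))

/-- The form `ω` has quasihomogeneous degree at most `d`. -/
def DegreeLE (v : τ → ℚ) (x : Fin n → τ) (ω : DForm n τ) (d : ℚ) : Prop :=
  ∀ s : Finset (Fin n), ∀ m ∈ (ω s).support, Finsupp.weight v m + ∑ i ∈ s, v (x i) ≤ d

/-- The origin is an isolated critical point of `f`. -/
def HasIsolatedCriticalPoint (f : MvPolynomial (Fin n) ℂ) : Prop :=
  (∀ i, eval (0 : Fin n → ℂ) (pderiv i f) = 0) ∧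
    ∀ᶠ a in 𝓝[≠] (0 : Fin n → ℂ), ∃ i, eval a (pderiv i f) ≠ 0

/-- The monomial `n`-form `x^α dx_0 ∧ ⋯ ∧ dx_{n-1}`. -/
def topMonomial (α : Fin n →₀ ℕ) : DForm n (Fin n) := Pi.single Finset.univ (monomial α 1)

theorem topMonomial_mem (α : Fin n →₀ ℕ) : topMonomial α ∈ forms n (Fin n) n := by
  intro s hs
  have h : s ≠ Finset.univ := by
    rintro rfl
    simp at hs
  simp [topMonomial, h]

/-- The quasihomogeneous degree of `x^α dx_0 ∧ ⋯ ∧ dx_{n-1}`. -/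
def topDegree (w : Fin n → ℚ) (α : Fin n →₀ ℕ) : ℚ := Finsupp.weight w α + ∑ i, w i

/-- The space `Λⁿ / df ∧ Λⁿ⁻¹` of relative `n`-forms. -/
abbrev RelativeForms (f : MvPolynomial (Fin n) ℂ) : Type :=
  (forms n (Fin n) n) ⧸
    (((forms n (Fin n) (n - 1)).map (wedgeLeft (extD id (ofFun f)))).submoduleOf
      (forms n (Fin n) n))

/-- The monomial `n`-forms with exponents `φ 0, …, φ (l-1)` form a basis of `Λⁿ / df ∧ Λⁿ⁻¹`. -/
def IsMonomialBasis (f : MvPolynomial (Fin n) ℂ) {l : ℕ} (φ : Fin l → Fin n →₀ ℕ) : Prop :=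
  ∃ b : Module.Basis (Fin l) ℂ (RelativeForms f),
    ∀ i, b i = Submodule.Quotient.mk ⟨topMonomial (φ i), topMonomial_mem (φ i)⟩

/-- Every polynomial `n`-form `μ` can be divided by `df` with a remainder in the span of the monomial
forms `μ_i = x^(φ i) dx_0 ∧ ⋯ ∧ dx_{n-1}`, `μ = ∑ c_i μ_i + df ∧ η`, in such a way that
`deg η ≤ deg μ - r` and `‖η‖ + ∑ |c_i| ≤ M ‖μ‖`. -/
def IsDivisionConstant (w : Fin n → ℚ) (r : ℚ) (f : MvPolynomial (Fin n) ℂ) {l : ℕ}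
    (φ : Fin l → Fin n →₀ ℕ) (M : ℝ) : Prop :=
  ∀ μ ∈ forms n (Fin n) n, ∃ (c : Fin l → ℂ) (η : DForm n (Fin n)),
    η ∈ forms n (Fin n) (n - 1) ∧
    μ = ∑ i, c i • topMonomial (φ i) + wedge (extD id (ofFun f)) η ∧
    (∀ d : ℚ, DegreeLE w id μ d → DegreeLE w id η (d - r)) ∧
    formNorm η + ∑ i, ‖c i‖ ≤ M * formNorm μ

/-- The division modulus `M(f)`: the smallest division constant over all monomial bases. -/
def divisionModulus (w : Fin n → ℚ) (r : ℚ) (f : MvPolynomial (Fin n) ℂ) : ℝ :=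
  sInf {M : ℝ | ∃ (l : ℕ) (φ : Fin l → Fin n →₀ ℕ),
    IsMonomialBasis f φ ∧ IsDivisionConstant w r f φ M}

/-- A monomial basis is optimal if the division with remainder in it satisfies the bound with the
smallest possible constant `M(f)`. -/
def IsOptimalBasis (w : Fin n → ℚ) (r : ℚ) (f : MvPolynomial (Fin n) ℂ) {l : ℕ}
    (φ : Fin l → Fin n →₀ ℕ) : Prop :=
  IsMonomialBasis f φ ∧ IsDivisionConstant w r f φ (divisionModulus w r f)

/-- The index set of the parameters `λ_s`: the (exponents of the) monomials of degree less than
`r`. -/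
abbrev Param (w : Fin n → ℚ) (r : ℚ) : Type := {α : Fin n →₀ ℕ // Finsupp.weight w α < r}

/-- For positive weights there are only finitely many parameters. -/
theorem finite_param (w : Fin n → ℚ) (hw : ∀ i, 0 < w i) (r : ℚ) : Finite (Param w r) := by
  have key : ∀ (s : Param w r) (i : Fin n), s.1 i ≤ ⌈r / w i⌉₊ := by
    intro s i
    have h1 : (s.1 i : ℚ) * w i ≤ Finsupp.weight w s.1 := by
      rw [Finsupp.weight_apply, Finsupp.sum_fintype _ _ (by simp)]
      have := Finset.single_le_sum (f := fun j => s.1 j • w j)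
        (fun j _ => by
          have := hw j
          positivity) (Finset.mem_univ i)
      simpa [nsmul_eq_mul] using this
    have h2 : (s.1 i : ℚ) ≤ r / w i := by
      rw [le_div_iff₀ (hw i)]
      exact h1.trans s.2.le
    exact_mod_cast h2.trans (Nat.le_ceil _)
  refine Finite.of_injective
    (fun (s : Param w r) (i : Fin n) => (⟨s.1 i, Nat.lt_succ_of_le (key s i)⟩ :
      Fin (⌈r / w i⌉₊ + 1))) ?_
  intro s t h
  apply Subtype.ext
  ext i
  simpa using congrArg Fin.val (congrFun h i)

/-- The weights of the variables `x, λ`, with `deg λ_s = r - deg f_s`. -/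
def weightXL (w : Fin n → ℚ) (r : ℚ) : Fin n ⊕ Param w r → ℚ :=
  Sum.elim w fun s => r - Finsupp.weight w s.1

/-- The weights of the variables `F, λ` (here `none` stands for the formal variable `F`), with
`deg F = r` and `deg λ_s = r - deg f_s`. -/
def weightFL (w : Fin n → ℚ) (r : ℚ) : Option (Param w r) → ℚ :=
  fun o => o.elim r fun s => r - Finsupp.weight w s.1

/-- The general semiquasihomogeneous polynomial `F = f + ∑ λ_s f_s` with principal part `f`, the sum
being over all monomials `f_s` of degree less than `r`. -/
def generalPoly (w : Fin n → ℚ) (r : ℚ) (f : MvPolynomial (Fin n) ℂ) :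
    MvPolynomial (Fin n ⊕ Param w r) ℂ :=
  rename Sum.inl f + ∑ᶠ s : Param w r, X (Sum.inr s) * rename Sum.inl (monomial s.1 (1 : ℂ))

/-- A form without parameters, regarded as a form with parameters `σ`. -/
def liftForm {σ : Type} (ω : DForm n (Fin n)) : DForm n (Fin n ⊕ σ) :=
  fun s => rename Sum.inl (ω s)

/-- The substitution of the polynomial `F` for the formal variable `F`, `ℂ[F, λ] → ℂ[x, λ]`. -/
def substF {σ : Type} (F : MvPolynomial (Fin n ⊕ σ) ℂ) :
    MvPolynomial (Option σ) ℂ →ₐ[ℂ] MvPolynomial (Fin n ⊕ σ) ℂ :=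
  aeval fun o => o.elim F fun s => X (Sum.inr s)

end PolyForms

end

/-! The engine is Cartan's formula for the Euler field `E = ∑ w_i x_i ∂/∂x_i`. If `ω` is an
`(n-1)`-form in `x` alone of degree `j > 0`, then `j ω = ι_E dω + d ι_E ω`. Divide the `n`-form `dω
= ∑ c_i μ_i + df ∧ η`. Since `ι_E μ_i = j ω_i - d ι_E ω_i` whenever `c_i ≠ 0`, and `ι_E (df ∧ η) = r
f η - df ∧ ι_E η`, it follows that `ω = ∑ c_i ω_i + f η₁ - df ∧ ζ + exact`, where `η₁ = (r/j) η` and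
`ζ = (1/j) ι_E η` (`euler_decomposition`).

Now substitute `f = F - ∑ λ_s f_s`. This gives `F η₁ - dF ∧ ζ + ∑ λ_s (df_s ∧ ζ - f_s η₁)`
(`liftForm_sub_wedgeD`). The forms `η₁` and `df_s ∧ ζ - f_s η₁` are free of parameters and have
degree below `j`, because `deg f_s < r`. Representable forms are stable under multiplication by
`λ_s`, and also by `F`, since `F dξ' = d(F ξ') - dF ∧ ξ'`. Induction on the degree therefore applies
(`representable_of_lower`, `representable_liftForm`). A form with parameters is a sum of monomials
in `λ` times parameter-free forms of no larger degree.

For the bounds, `‖dω‖ ≤ (j/w₀) ‖ω‖` with `w₀` a lower bound of the weights, division costs a factor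
`M`, and the Euler step costs at most `G/j`, where `G` is `reductionConstant`. The factors `j`
cancel, so each step multiplies the bound by `M G/w₀`. With unit weights `G ≤ (n-1) r^(n+3)`; the
factor `n-1` is at most the current degree and is absorbed by the factorial.

Optimal bases exist for two reasons. The torus action and the Nullstellensatz put a power of every
variable into the Jacobian ideal, so there are finitely many monomial bases and each has some
division constant. For a fixed basis the set of division constants is closed by compactness and
bounded below by `1`, so the infimum is attained (`exists_isOptimalBasis`). -/

noncomputable section

namespace PolyForms

variable {n : ℕ} {τ : Type}

/-! ### Exterior multiplication by `dx_i` and contraction with `∂/∂x_i` -/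

/-- The sign of `dx_i ∧ dx_{u \ i}` relative to `dx_u`. -/
def dxSign (i : Fin n) (u : Finset (Fin n)) : ℂ := (-1) ^ (u.filter fun j => j < i).card

theorem dxSign_mul_self (i : Fin n) (u : Finset (Fin n)) : dxSign i u * dxSign i u = 1 := by
  rw [dxSign, ← mul_pow]
  simp

theorem norm_dxSign (i : Fin n) (u : Finset (Fin n)) : ‖dxSign i u‖ = 1 := by
  simp [dxSign]

theorem dxSign_erase_self (i : Fin n) (u : Finset (Fin n)) : dxSign i (u.erase i) = dxSign i u := by
  rw [dxSign, dxSign, Finset.filter_erase, Finset.erase_eq_of_notMem (by simp)]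

theorem dxSign_insert_self (i : Fin n) (u : Finset (Fin n)) :
    dxSign i (insert i u) = dxSign i u := by
  rw [dxSign, dxSign, Finset.filter_insert]
  simp

theorem dxSign_insert {i j : Fin n} {u : Finset (Fin n)} (hj : j ∉ u) :
    dxSign i (insert j u) = (if j < i then -1 else 1) * dxSign i u := by
  rw [dxSign, dxSign, Finset.filter_insert]
  split_ifs with h
  · rw [Finset.card_insert_of_notMem (by simp [hj]), pow_succ]
    ring
  · simp

/-- The exterior product `ω ↦ dx_i ∧ ω`. -/
def mulDx (i : Fin n) : DForm n τ →ₗ[MvPolynomial τ ℂ] DForm n τ where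
  toFun ω := fun u => if i ∈ u then C (dxSign i u) * ω (u.erase i) else 0
  map_add' a b := by
    funext u
    by_cases h : i ∈ u <;> simp [h, mul_add]
  map_smul' c a := by
    funext u
    by_cases h : i ∈ u <;> simp [h, mul_left_comm]

/-- The contraction of a form with the vector field `∂/∂x_i`. -/
def contrDx (i : Fin n) : DForm n τ →ₗ[MvPolynomial τ ℂ] DForm n τ where
  toFun ω := fun u => if i ∈ u then 0 else C (dxSign i u) * ω (insert i u)
  map_add' a b := by
    funext u
    by_cases h : i ∈ u <;> simp [h, mul_add]
  map_smul' c a := by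
    funext u
    by_cases h : i ∈ u <;> simp [h, mul_left_comm]

theorem mulDx_apply (i : Fin n) (ω : DForm n τ) (u : Finset (Fin n)) :
    mulDx i ω u = if i ∈ u then C (dxSign i u) * ω (u.erase i) else 0 := rfl

theorem contrDx_apply (i : Fin n) (ω : DForm n τ) (u : Finset (Fin n)) :
    contrDx i ω u = if i ∈ u then 0 else C (dxSign i u) * ω (insert i u) := rfl

theorem mulDx_contrDx_self_apply (i : Fin n) (ω : DForm n τ) (u : Finset (Fin n)) :
    mulDx i (contrDx i ω) u = if i ∈ u then ω u else 0 := by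
  rw [mulDx_apply, contrDx_apply]
  split_ifs with h h'
  · simp at h'
  · rw [dxSign_erase_self, ← mul_assoc, ← C_mul, dxSign_mul_self, Finset.insert_erase h]
    simp
  · rfl

/-- The anticommutation relation behind every contraction identity below. For `i ≠ j` the two terms
cancel because exactly one of `i < j` and `j < i` holds, so exactly one of the two signs changes. -/
theorem mulDx_contrDx_add (i j : Fin n) (ω : DForm n τ) :
    mulDx i (contrDx j ω) + contrDx j (mulDx i ω) = if i = j then ω else 0 := by
  funext u
  rw [Pi.add_apply]
  split_ifs with hij
  · subst hij
    rw [mulDx_contrDx_self_apply, contrDx_apply, mulDx_apply]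
    by_cases h : i ∈ u
    · simp [h]
    · rw [if_neg h, if_neg h, if_pos (Finset.mem_insert_self i u), dxSign_insert_self,
        ← mul_assoc, ← C_mul, dxSign_mul_self, Finset.erase_insert h]
      simp
  · rw [mulDx_apply, contrDx_apply, contrDx_apply, mulDx_apply]
    by_cases hi : i ∈ u
    · by_cases hj : j ∈ u
      · have : j ∈ u.erase i := Finset.mem_erase.2 ⟨Ne.symm hij, hj⟩
        simp [hi, hj, this]
      · have hj' : j ∉ u.erase i := fun h => hj (Finset.mem_of_mem_erase h)
        have hi' : i ∈ insert j u := Finset.mem_insert_of_mem hi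
        have e : (insert j u).erase i = insert j (u.erase i) :=
          Finset.erase_insert_of_ne (Ne.symm hij)
        rw [if_pos hi, if_neg hj', if_neg hj, if_pos hi', e, ← mul_assoc, ← mul_assoc, ← C_mul,
          ← C_mul, ← add_mul, ← C_add]
        have h1 : dxSign j u = (if i < j then -1 else 1) * dxSign j (u.erase i) := by
          conv_lhs => rw [← Finset.insert_erase hi]
          exact dxSign_insert (by simp)
        have h2 := dxSign_insert (i := i) hj
        have : dxSign i u * dxSign j (u.erase i) + dxSign j u * dxSign i (insert j u) = 0 := by
          rw [h1, h2]
          rcases lt_or_gt_of_ne hij with h | h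
          · rw [if_pos h, if_neg h.asymm]
            ring
          · rw [if_neg h.asymm, if_pos h]
            ring
        rw [this]
        simp
    · have hi' : i ∉ insert j u := by simp [hi, hij]
      simp [hi, hi']

/-! ### Coefficientwise derivatives -/

/-- The derivative of all coefficients of a form. -/
def coeffDeriv (a : τ) : DForm n τ →ₗ[ℂ] DForm n τ where
  toFun ω := fun u => pderiv a (ω u)
  map_add' := by
    intro a b
    funext u
    simp
  map_smul' := by
    intro a b
    funext u
    simp

theorem coeffDeriv_apply (a : τ) (ω : DForm n τ) (u : Finset (Fin n)) :
    coeffDeriv a ω u = pderiv a (ω u) := rfl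

theorem coeffDeriv_smul (a : τ) (g : MvPolynomial τ ℂ) (ω : DForm n τ) :
    coeffDeriv a (g • ω) = pderiv a g • ω + g • coeffDeriv a ω := by
  funext u
  simp only [coeffDeriv_apply, Pi.smul_apply, Pi.add_apply, smul_eq_mul, Derivation.leibniz]
  ring

theorem coeffDeriv_contrDx (a : τ) (i : Fin n) (ω : DForm n τ) :
    coeffDeriv a (contrDx i ω) = contrDx i (coeffDeriv a ω) := by
  funext u
  simp only [coeffDeriv_apply, contrDx_apply]
  split_ifs <;> simp

/-! ### The operators `d` and `dg ∧` as sums over `dx_i ∧`. -/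

theorem extD_eq_sum (x : Fin n → τ) (ω : DForm n τ) :
    extD x ω = ∑ i, mulDx i (coeffDeriv (x i) ω) := by
  funext u
  rw [Finset.sum_apply]
  simp only [mulDx_apply, coeffDeriv_apply, extD, Finset.sum_ite_mem, Finset.univ_inter, dxSign]
  simp

/-- The exterior product `ω ↦ dg ∧ ω`. -/
def wedgeD (x : Fin n → τ) (g : MvPolynomial τ ℂ) : DForm n τ →ₗ[MvPolynomial τ ℂ] DForm n τ :=
  ∑ i, pderiv (x i) g • mulDx i

theorem wedgeD_apply (x : Fin n → τ) (g : MvPolynomial τ ℂ) (ω : DForm n τ) :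
    wedgeD x g ω = ∑ i, pderiv (x i) g • mulDx i ω := by
  simp [wedgeD]

theorem extD_ofFun_apply (x : Fin n → τ) (g : MvPolynomial τ ℂ) (s : Finset (Fin n)) :
    extD x (ofFun g) s = ∑ i, if s = {i} then pderiv (x i) g else 0 := by
  rw [extD_eq_sum, Finset.sum_apply]
  refine Finset.sum_congr rfl fun i _ => ?_
  rw [mulDx_apply, coeffDeriv_apply, ofFun]
  by_cases hi : i ∈ s
  · rw [if_pos hi]
    by_cases hs : s = {i}
    · subst hs
      simp [dxSign, Finset.filter_singleton]
    · have : s.erase i ≠ ∅ := by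
        intro h
        rcases Finset.erase_eq_empty_iff s i |>.1 h with h | h
        · simp [h] at hi
        · exact hs h
      rw [Pi.single_eq_of_ne this, if_neg hs]
      simp
  · rw [if_neg hi, if_neg]
    rintro rfl
    simp at hi

/-- Only the singletons `s = {i}` contribute to the product with a `1`-form, and the inversions of
`{i}` against `u \ {i}` are the `j ∈ u` with `j < i`. This trades `wedge` for an operator linear
over polynomials. -/
theorem wedge_extD_ofFun (x : Fin n → τ) (g : MvPolynomial τ ℂ) (ω : DForm n τ) :
    wedge (extD x (ofFun g)) ω = wedgeD x g ω := by
  funext u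
  rw [wedgeD_apply, Finset.sum_apply]
  simp only [wedge, extD_ofFun_apply, Finset.sum_mul, Finset.mul_sum]
  rw [Finset.sum_comm]
  refine Finset.sum_congr rfl fun i _ => ?_
  rw [Pi.smul_apply, mulDx_apply]
  have h : ∀ s ∈ u.powerset, (-1 : MvPolynomial τ ℂ) ^ inversions s (u \ s) *
      ((if s = {i} then pderiv (x i) g else 0) * ω (u \ s)) =
      if s = {i} then (-1 : MvPolynomial τ ℂ) ^ inversions {i} (u \ {i}) *
        (pderiv (x i) g * ω (u \ {i})) else 0 := by
    intro s _
    split_ifs with h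
    · rw [h]
    · simp
  rw [Finset.sum_congr rfl h, Finset.sum_ite_eq']
  simp only [Finset.mem_powerset, Finset.singleton_subset_iff]
  split_ifs with hi
  · have e : inversions {i} (u \ {i}) = (u.filter fun j => j < i).card := by
      unfold inversions
      refine Finset.card_nbij' (fun p => p.2) (fun j => (i, j)) ?_ ?_ ?_ ?_
      · rintro ⟨a, b⟩
        simp only [Finset.coe_filter, Finset.mem_product, Finset.mem_singleton, Finset.mem_sdiff,
          Set.mem_ofPred_eq]
        rintro ⟨⟨rfl, h1, h2⟩, h3⟩
        exact ⟨h1, h3⟩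
      · intro j
        simp only [Finset.coe_filter, Finset.mem_product, Finset.mem_singleton, Finset.mem_sdiff,
          Set.mem_ofPred_eq]
        rintro ⟨h1, h2⟩
        exact ⟨⟨trivial, h1, h2.ne⟩, h2⟩
      · rintro ⟨a, b⟩
        simp only [Finset.coe_filter, Finset.mem_product, Finset.mem_singleton, Set.mem_ofPred_eq]
        rintro ⟨⟨rfl, _⟩, _⟩
        rfl
      · intro j _
        rfl
    rw [e, Finset.sdiff_singleton_eq_erase, dxSign]
    simp only [C_pow, C_neg, C_1, smul_eq_mul]
    ring
  · simp

theorem extD_add (x : Fin n → τ) (ω η : DForm n τ) : extD x (ω + η) = extD x ω + extD x η := by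
  simp only [extD_eq_sum, map_add, Finset.sum_add_distrib]

theorem extD_smul (x : Fin n → τ) (c : ℂ) (ω : DForm n τ) : extD x (c • ω) = c • extD x ω := by
  funext u
  rw [extD_eq_sum, extD_eq_sum, Finset.sum_apply, Pi.smul_apply, Finset.sum_apply, Finset.smul_sum]
  refine Finset.sum_congr rfl fun i _ => ?_
  simp only [mulDx_apply, coeffDeriv_apply, Pi.smul_apply, map_smul]
  split_ifs <;> simp

/-- The exterior derivative as a linear map. -/
def extDLinear (x : Fin n → τ) : DForm n τ →ₗ[ℂ] DForm n τ where
  toFun := extD x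
  map_add' := extD_add x
  map_smul' := extD_smul x

theorem extDLinear_apply (x : Fin n → τ) (ω : DForm n τ) : extDLinear x ω = extD x ω := rfl

theorem extD_poly_smul (x : Fin n → τ) (g : MvPolynomial τ ℂ) (ω : DForm n τ) :
    extD x (g • ω) = wedgeD x g ω + g • extD x ω := by
  simp only [extD_eq_sum, wedgeD_apply, coeffDeriv_smul, map_add, Finset.sum_add_distrib,
    map_smul, Finset.smul_sum]

theorem wedgeD_add (x : Fin n → τ) (g h : MvPolynomial τ ℂ) (ω : DForm n τ) :
    wedgeD x (g + h) ω = wedgeD x g ω + wedgeD x h ω := by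
  simp only [wedgeD_apply, map_add, add_smul, Finset.sum_add_distrib]

/-! ### Contraction with the Euler field -/

/-- Contraction of forms with the Euler vector field `∑ w_i x_i ∂/∂x_i`. -/
def contrEuler (w : Fin n → ℚ) :
    DForm n (Fin n) →ₗ[MvPolynomial (Fin n) ℂ] DForm n (Fin n) :=
  ∑ i, (C (w i : ℂ) * X i : MvPolynomial (Fin n) ℂ) • contrDx i

theorem contrEuler_apply (w : Fin n → ℚ) (ω : DForm n (Fin n)) :
    contrEuler w ω = ∑ i, (C (w i : ℂ) * X i : MvPolynomial (Fin n) ℂ) • contrDx i ω := by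
  simp [contrEuler]

/-- The Euler field multiplies each monomial by its weight, which is `r` throughout the support of
`g`. -/
theorem euler_identity {w : Fin n → ℚ} {g : MvPolynomial (Fin n) ℂ} {r : ℚ}
    (hg : IsWeightedHomogeneous w g r) :
    ∑ i, (C (w i : ℂ) * X i) * pderiv i g = C (r : ℂ) * g := by
  have key : ∀ m ∈ g.support, ∑ i, (C (w i : ℂ) * X i) * pderiv i (monomial m (g.coeff m)) =
      C (r : ℂ) * monomial m (g.coeff m) := by
    intro m hm
    have hw := hg (mem_support_iff.1 hm)
    have h1 : ∀ i, (C (w i : ℂ) * X i) * pderiv i (monomial m (g.coeff m)) =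
        C ((w i * m i : ℚ) : ℂ) * monomial m (g.coeff m) := by
      intro i
      rw [mul_assoc, X_mul_pderiv_monomial, nsmul_eq_mul, ← mul_assoc]
      simp
    rw [Finset.sum_congr rfl fun i _ => h1 i, ← Finset.sum_mul, ← map_sum, ← hw]
    congr 2
    rw [Finsupp.weight_apply, Finsupp.sum_fintype _ _ (by simp)]
    push_cast
    refine Finset.sum_congr rfl fun i _ => ?_
    simp [mul_comm]
  conv_lhs => rw [g.as_sum]
  conv_rhs => rw [g.as_sum]
  simp only [map_sum, Finset.mul_sum]
  rw [Finset.sum_comm]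
  refine Finset.sum_congr rfl fun m hm => ?_
  rw [← key m hm]

/-- Contraction is an antiderivation, and `ι_E dg = r g` by Euler's identity. -/
theorem contrEuler_wedgeD {w : Fin n → ℚ} {g : MvPolynomial (Fin n) ℂ} {r : ℚ}
    (hg : IsWeightedHomogeneous w g r) (ω : DForm n (Fin n)) :
    contrEuler w (wedgeD id g ω) = (C (r : ℂ) * g) • ω - wedgeD id g (contrEuler w ω) := by
  rw [eq_sub_iff_add_eq, ← euler_identity hg]
  simp only [contrEuler_apply, wedgeD_apply, map_sum, map_smul, Finset.smul_sum, id_eq]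
  conv_lhs =>
    arg 2
    rw [Finset.sum_comm]
  rw [← Finset.sum_add_distrib, Finset.sum_smul]
  refine Finset.sum_congr rfl fun j _ => ?_
  rw [← Finset.sum_add_distrib]
  have : ∀ i ∈ Finset.univ, pderiv j g • (C (w i : ℂ) * X i : MvPolynomial (Fin n) ℂ) •
        contrDx i (mulDx j ω) +
      (C (w i : ℂ) * X i : MvPolynomial (Fin n) ℂ) • pderiv j g • mulDx j (contrDx i ω) =
      if j = i then (C (w j : ℂ) * X j * pderiv j g) • ω else 0 := by
    intro i _
    rw [smul_comm (pderiv j g), ← smul_add, ← smul_add, add_comm, mulDx_contrDx_add]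
    split_ifs with h
    · subst h
      rw [smul_smul]
    · simp
  rw [Finset.sum_congr rfl this]
  simp

/-- By anticommutation only the diagonal terms survive: `∑ w_i x_i ∂_i ω`, which multiplies the
coefficient of `dx_u` by `j - ∑_{i ∈ u} w_i`, and `∑ w_i dx_i ∧ ι_i ω`, which supplies the missing
`∑_{i ∈ u} w_i`. -/
theorem cartan_euler {w : Fin n → ℚ} {ω : DForm n (Fin n)} {j : ℚ}
    (hω : IsQuasihomogeneous w id ω j) :
    contrEuler w (extD id ω) + extD id (contrEuler w ω) = (j : ℂ) • ω := by
  simp only [contrEuler_apply, extD_eq_sum, map_sum, map_smul, id_eq,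
    coeffDeriv_smul, coeffDeriv_contrDx, map_add]
  rw [← Finset.sum_add_distrib]
  have h1 : ∀ i ∈ (Finset.univ : Finset (Fin n)), (∑ j : Fin n,
      (C (w j : ℂ) * X j : MvPolynomial (Fin n) ℂ) •
        contrDx j (mulDx i (coeffDeriv i ω)) +
      ∑ j : Fin n, (pderiv i (C (w j : ℂ) * X j : MvPolynomial (Fin n) ℂ) • mulDx i (contrDx j ω) +
        (C (w j : ℂ) * X j : MvPolynomial (Fin n) ℂ) •
          mulDx i (contrDx j (coeffDeriv i ω)))) =
      (C (w i : ℂ) * X i : MvPolynomial (Fin n) ℂ) • coeffDeriv i ω +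
        (C (w i : ℂ) : MvPolynomial (Fin n) ℂ) • mulDx i (contrDx i ω) := by
    intro i _
    rw [← Finset.sum_add_distrib]
    have h2 : ∀ j ∈ (Finset.univ : Finset (Fin n)), (C (w j : ℂ) * X j : MvPolynomial (Fin n) ℂ) •
        contrDx j (mulDx i (coeffDeriv i ω)) +
      (pderiv i (C (w j : ℂ) * X j : MvPolynomial (Fin n) ℂ) • mulDx i (contrDx j ω) +
        (C (w j : ℂ) * X j : MvPolynomial (Fin n) ℂ) •
          mulDx i (contrDx j (coeffDeriv i ω))) = if i = j then
      (C (w i : ℂ) * X i : MvPolynomial (Fin n) ℂ) • coeffDeriv i ω +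
        (C (w i : ℂ) : MvPolynomial (Fin n) ℂ) • mulDx i (contrDx i ω) else 0 := by
      intro j _
      rw [add_left_comm, ← smul_add, add_comm (contrDx j _), mulDx_contrDx_add]
      split_ifs with h
      · subst h
        rw [add_comm]
        congr 2
        simp [Derivation.leibniz]
      · simp [Derivation.leibniz, pderiv_X_of_ne (Ne.symm h)]
    rw [Finset.sum_congr rfl h2]
    simp
  rw [Finset.sum_congr rfl h1, Finset.sum_add_distrib]
  funext u
  rw [Pi.add_apply, Finset.sum_apply, Finset.sum_apply]
  simp only [Pi.smul_apply, coeffDeriv_apply, smul_eq_mul, mulDx_contrDx_self_apply, mul_ite,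
    mul_zero, Finset.sum_ite_mem, Finset.univ_inter]
  rw [euler_identity (hω u), ← Finset.sum_mul, ← add_mul, ← map_sum, ← C_add, ← C_mul']
  congr 2
  push_cast
  simp

/-! ### The norm of polynomials -/

theorem polyNorm_eq_sum {p : MvPolynomial τ ℂ} {T : Finset (τ →₀ ℕ)} (hT : p.support ⊆ T) :
    polyNorm p = ∑ m ∈ T, ‖p.coeff m‖ := by
  refine Finset.sum_subset hT fun m _ hm => ?_
  rw [notMem_support_iff.1 hm, norm_zero]

theorem polyNorm_nonneg (p : MvPolynomial τ ℂ) : 0 ≤ polyNorm p :=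
  Finset.sum_nonneg fun _ _ => norm_nonneg _

@[simp]
theorem polyNorm_zero : polyNorm (0 : MvPolynomial τ ℂ) = 0 := by
  simp [polyNorm]

theorem polyNorm_add_le (p q : MvPolynomial τ ℂ) : polyNorm (p + q) ≤ polyNorm p + polyNorm q := by
  classical
  rw [polyNorm_eq_sum (T := p.support ∪ q.support) support_add,
    polyNorm_eq_sum (p := p) (T := p.support ∪ q.support) Finset.subset_union_left,
    polyNorm_eq_sum (p := q) (T := p.support ∪ q.support) Finset.subset_union_right,
    ← Finset.sum_add_distrib]
  refine Finset.sum_le_sum fun m _ => ?_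
  rw [coeff_add]
  exact norm_add_le _ _

theorem polyNorm_sum_le {ι : Type*} (s : Finset ι) (p : ι → MvPolynomial τ ℂ) :
    polyNorm (∑ i ∈ s, p i) ≤ ∑ i ∈ s, polyNorm (p i) :=
  Finset.le_sum_of_subadditive polyNorm polyNorm_zero.le polyNorm_add_le s p

@[simp]
theorem polyNorm_monomial (m : τ →₀ ℕ) (c : ℂ) : polyNorm (monomial m c) = ‖c‖ := by
  classical
  rw [polyNorm_eq_sum (T := {m}) support_monomial_subset]
  simp

theorem polyNorm_C_mul (c : ℂ) (p : MvPolynomial τ ℂ) : polyNorm (C c * p) = ‖c‖ * polyNorm p := by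
  have : (C c * p).support ⊆ p.support := by
    rw [C_mul']
    exact support_smul
  rw [polyNorm_eq_sum this, polyNorm, Finset.mul_sum]
  simp

theorem polyNorm_mul_le (p q : MvPolynomial τ ℂ) : polyNorm (p * q) ≤ polyNorm p * polyNorm q := by
  have h : p * q = ∑ m ∈ p.support, ∑ m' ∈ q.support,
      monomial (m + m') (p.coeff m * q.coeff m') := by
    conv_lhs => rw [p.as_sum, q.as_sum, Finset.sum_mul_sum]
    simp only [monomial_mul]
  rw [h, polyNorm.eq_1 p, polyNorm.eq_1 q, Finset.sum_mul_sum]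
  refine (polyNorm_sum_le _ _).trans (Finset.sum_le_sum fun m _ =>
    (polyNorm_sum_le _ _).trans (Finset.sum_le_sum fun m' _ => ?_))
  rw [polyNorm_monomial, norm_mul]

theorem polyNorm_weightedHomogeneousComponent_le (v : τ → ℚ) (d : ℚ) (p : MvPolynomial τ ℂ) :
    polyNorm (weightedHomogeneousComponent v d p) ≤ polyNorm p := by
  rw [polyNorm_eq_sum (T := p.support), polyNorm]
  · refine Finset.sum_le_sum fun m _ => ?_
    rw [coeff_weightedHomogeneousComponent]
    split_ifs <;> simp
  · intro m hm
    rw [mem_support_iff, coeff_weightedHomogeneousComponent] at hm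
    rw [mem_support_iff]
    contrapose! hm
    simp [hm]

/-- The derivatives of `x^m` have norms `m_i`, which add up to the ordinary degree of `m`. Summing
over `i` before estimating avoids an extra factor `n`. -/
theorem sum_polyNorm_pderiv_le {b : ℝ} {p : MvPolynomial (Fin n) ℂ}
    (hp : ∀ m ∈ p.support, ∑ i, (m i : ℝ) ≤ b) :
    ∑ i, polyNorm (pderiv i p) ≤ b * polyNorm p := by
  have h1 : ∀ i, polyNorm (pderiv i p) ≤ ∑ m ∈ p.support, m i * ‖p.coeff m‖ := by
    intro i
    conv_lhs => rw [p.as_sum, map_sum]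
    refine (polyNorm_sum_le _ _).trans (Finset.sum_le_sum fun m _ => ?_)
    rw [pderiv_monomial, polyNorm_monomial, norm_mul, mul_comm]
    simp
  refine (Finset.sum_le_sum fun i _ => h1 i).trans ?_
  rw [Finset.sum_comm, polyNorm, Finset.mul_sum]
  refine Finset.sum_le_sum fun m hm => ?_
  rw [← Finset.sum_mul]
  exact mul_le_mul_of_nonneg_right (hp m hm) (norm_nonneg _)

/-! ### The norm of forms -/

theorem formNorm_nonneg (ω : DForm n τ) : 0 ≤ formNorm ω :=
  Finset.sum_nonneg fun _ _ => polyNorm_nonneg _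

@[simp]
theorem formNorm_zero : formNorm (0 : DForm n τ) = 0 := by
  simp [formNorm]

theorem formNorm_add_le (ω η : DForm n τ) : formNorm (ω + η) ≤ formNorm ω + formNorm η := by
  rw [formNorm, formNorm, formNorm, ← Finset.sum_add_distrib]
  exact Finset.sum_le_sum fun s _ => polyNorm_add_le _ _

theorem formNorm_sum_le {ι : Type*} (s : Finset ι) (ω : ι → DForm n τ) :
    formNorm (∑ i ∈ s, ω i) ≤ ∑ i ∈ s, formNorm (ω i) :=
  Finset.le_sum_of_subadditive formNorm formNorm_zero.le formNorm_add_le s ω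

theorem formNorm_poly_smul_le (g : MvPolynomial τ ℂ) (ω : DForm n τ) :
    formNorm (g • ω) ≤ polyNorm g * formNorm ω := by
  rw [formNorm, formNorm, Finset.mul_sum]
  exact Finset.sum_le_sum fun s _ => polyNorm_mul_le _ _

theorem formNorm_smul (c : ℂ) (ω : DForm n τ) : formNorm (c • ω) = ‖c‖ * formNorm ω := by
  rw [formNorm, formNorm, Finset.mul_sum]
  refine Finset.sum_congr rfl fun s _ => ?_
  rw [Pi.smul_apply, ← C_mul', polyNorm_C_mul]

@[simp]
theorem formNorm_single (s : Finset (Fin n)) (p : MvPolynomial τ ℂ) :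
    formNorm (Pi.single s p : DForm n τ) = polyNorm p := by
  rw [formNorm, Finset.sum_eq_single s]
  · simp
  · intro t _ ht
    simp [ht]
  · simp

/-- Up to sign, `dx_i ∧` only moves coefficients, injectively, since `u ↦ u.erase i` is injective on
the sets containing `i`. -/
theorem formNorm_mulDx_le (i : Fin n) (ω : DForm n τ) : formNorm (mulDx i ω) ≤ formNorm ω := by
  have h : formNorm (mulDx i ω) =
      ∑ u : Finset (Fin n) with i ∈ u, polyNorm (ω (u.erase i)) := by
    rw [formNorm, Finset.sum_filter]
    refine Finset.sum_congr rfl fun u _ => ?_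
    rw [mulDx_apply]
    split_ifs
    · rw [polyNorm_C_mul, norm_dxSign, one_mul]
    · exact polyNorm_zero
  rw [h, formNorm]
  have inj : Set.InjOn (fun u : Finset (Fin n) => u.erase i)
      (Finset.univ.filter fun u : Finset (Fin n) => i ∈ u) := by
    intro u hu v hv huv
    simp only [Finset.coe_filter, Finset.mem_univ, true_and, Set.mem_ofPred_eq] at hu hv
    rw [← Finset.insert_erase hu, ← Finset.insert_erase hv]
    exact congrArg _ huv
  rw [← Finset.sum_image (f := fun u => polyNorm (ω u)) inj]
  exact Finset.sum_le_sum_of_subset_of_nonneg (Finset.subset_univ _)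
    fun _ _ _ => polyNorm_nonneg _

theorem formNorm_contrDx_le (i : Fin n) (ω : DForm n τ) :
    formNorm (contrDx i ω) ≤ formNorm ω := by
  have h : formNorm (contrDx i ω) =
      ∑ u : Finset (Fin n) with i ∉ u, polyNorm (ω (insert i u)) := by
    rw [formNorm, Finset.sum_filter]
    refine Finset.sum_congr rfl fun u _ => ?_
    rw [contrDx_apply]
    by_cases hi : i ∈ u
    · simp [hi]
    · rw [if_neg hi, if_pos hi, polyNorm_C_mul, norm_dxSign, one_mul]
  rw [h, formNorm]
  have inj : Set.InjOn (fun u : Finset (Fin n) => insert i u)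
      (Finset.univ.filter fun u : Finset (Fin n) => i ∉ u) := by
    intro u hu v hv huv
    simp only [Finset.coe_filter, Finset.mem_univ, true_and, Set.mem_ofPred_eq] at hu hv
    rw [← Finset.erase_insert hu, ← Finset.erase_insert hv]
    exact congrArg (fun t => Finset.erase t i) huv
  rw [← Finset.sum_image (f := fun u => polyNorm (ω u)) inj]
  exact Finset.sum_le_sum_of_subset_of_nonneg (Finset.subset_univ _)
    fun _ _ _ => polyNorm_nonneg _

theorem formNorm_wedgeD_le (x : Fin n → τ) (g : MvPolynomial τ ℂ) (ω : DForm n τ) :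
    formNorm (wedgeD x g ω) ≤ (∑ i, polyNorm (pderiv (x i) g)) * formNorm ω := by
  rw [wedgeD_apply, Finset.sum_mul]
  refine (formNorm_sum_le _ _).trans (Finset.sum_le_sum fun i _ => ?_)
  exact (formNorm_poly_smul_le _ _).trans
    (mul_le_mul_of_nonneg_left (formNorm_mulDx_le _ _) (polyNorm_nonneg _))

theorem formNorm_extD_le {b : ℝ} {ω : DForm n (Fin n)}
    (hω : ∀ s, ∀ m ∈ (ω s).support, ∑ i, (m i : ℝ) ≤ b) :
    formNorm (extD id ω) ≤ b * formNorm ω := by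
  rw [extD_eq_sum]
  refine ((formNorm_sum_le _ _).trans (Finset.sum_le_sum fun i _ => formNorm_mulDx_le _ _)).trans ?_
  simp only [formNorm, coeffDeriv_apply, id_eq]
  rw [Finset.sum_comm, Finset.mul_sum]
  exact Finset.sum_le_sum fun s _ => sum_polyNorm_pderiv_le (hω s)

theorem formNorm_contrEuler_le {w : Fin n → ℚ} (hw : ∀ i, 0 < w i) (ω : DForm n (Fin n)) :
    formNorm (contrEuler w ω) ≤ ((∑ i, w i : ℚ) : ℝ) * formNorm ω := by
  rw [contrEuler_apply, Rat.cast_sum, Finset.sum_mul]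
  refine (formNorm_sum_le _ _).trans (Finset.sum_le_sum fun i _ => ?_)
  refine (formNorm_poly_smul_le _ _).trans
    (mul_le_mul ?_ (formNorm_contrDx_le _ _) (formNorm_nonneg _) (by exact_mod_cast (hw i).le))
  rw [polyNorm_C_mul, X, polyNorm_monomial]
  have : (0 : ℝ) < w i := by exact_mod_cast hw i
  simp [abs_of_pos this]

/-! ### Degrees of forms -/

theorem poly_smul_mem_forms {k : ℕ} (g : MvPolynomial τ ℂ) {ω : DForm n τ} (hω : ω ∈ forms n τ k) :
    g • ω ∈ forms n τ k := by
  intro s hs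
  simp [hω s hs]

theorem mulDx_mem_forms {k : ℕ} (i : Fin n) {ω : DForm n τ} (hω : ω ∈ forms n τ k) :
    mulDx i ω ∈ forms n τ (k + 1) := by
  intro s hs
  rw [mulDx_apply]
  split_ifs with hi
  · rw [hω, mul_zero]
    have := Finset.card_erase_add_one hi
    omega
  · rfl

theorem contrDx_mem_forms {k : ℕ} (i : Fin n) {ω : DForm n τ} (hω : ω ∈ forms n τ (k + 1)) :
    contrDx i ω ∈ forms n τ k := by
  intro s hs
  rw [contrDx_apply]
  split_ifs with hi
  · rfl
  · rw [hω, mul_zero]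
    rw [Finset.card_insert_of_notMem hi]
    omega

theorem coeffDeriv_mem_forms {k : ℕ} (a : τ) {ω : DForm n τ} (hω : ω ∈ forms n τ k) :
    coeffDeriv a ω ∈ forms n τ k := by
  intro s hs
  simp [coeffDeriv_apply, hω s hs]

theorem wedgeD_mem_forms {k : ℕ} (x : Fin n → τ) (g : MvPolynomial τ ℂ) {ω : DForm n τ}
    (hω : ω ∈ forms n τ k) : wedgeD x g ω ∈ forms n τ (k + 1) := by
  rw [wedgeD_apply]
  exact sum_mem fun i _ => poly_smul_mem_forms _ (mulDx_mem_forms i hω)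

theorem extD_mem_forms {k : ℕ} (x : Fin n → τ) {ω : DForm n τ}
    (hω : ω ∈ forms n τ k) : extD x ω ∈ forms n τ (k + 1) := by
  rw [extD_eq_sum]
  exact sum_mem fun i _ => mulDx_mem_forms i (coeffDeriv_mem_forms _ hω)

theorem contrEuler_mem_forms {k : ℕ} (w : Fin n → ℚ) {ω : DForm n (Fin n)}
    (hω : ω ∈ forms n (Fin n) (k + 1)) : contrEuler w ω ∈ forms n (Fin n) k := by
  rw [contrEuler_apply]
  exact sum_mem fun i _ => poly_smul_mem_forms _ (contrDx_mem_forms i hω)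

/-! ### Quasihomogeneous degrees of forms -/

section Quasihomogeneous

variable {v : τ → ℚ} {x : Fin n → τ} {ω η : DForm n τ} {d e : ℚ}

theorem isQuasihomogeneous_zero (v : τ → ℚ) (x : Fin n → τ) (d : ℚ) :
    IsQuasihomogeneous v x (0 : DForm n τ) d := fun _ => isWeightedHomogeneous_zero _ _ _

theorem IsQuasihomogeneous.add (hω : IsQuasihomogeneous v x ω d) (hη : IsQuasihomogeneous v x η d) :
    IsQuasihomogeneous v x (ω + η) d := fun s => (hω s).add (hη s)

theorem IsQuasihomogeneous.sum {ι : Type*} {t : Finset ι} {ω : ι → DForm n τ}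
    (h : ∀ i ∈ t, IsQuasihomogeneous v x (ω i) d) : IsQuasihomogeneous v x (∑ i ∈ t, ω i) d := by
  intro s
  rw [Finset.sum_apply]
  exact sum_mem (S := weightedHomogeneousSubmodule ℂ v _) fun i hi => h i hi s

theorem IsQuasihomogeneous.smul (hω : IsQuasihomogeneous v x ω d) (c : ℂ) :
    IsQuasihomogeneous v x (c • ω) d := fun s =>
  (weightedHomogeneousSubmodule ℂ v _).smul_mem c (hω s)

theorem IsQuasihomogeneous.poly_smul (hω : IsQuasihomogeneous v x ω d) {g : MvPolynomial τ ℂ}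
    (hg : IsWeightedHomogeneous v g e) : IsQuasihomogeneous v x (g • ω) (e + d) := by
  intro s
  rw [add_sub_assoc]
  exact hg.mul (hω s)

theorem IsQuasihomogeneous.mulDx (hω : IsQuasihomogeneous v x ω d) (i : Fin n) :
    IsQuasihomogeneous v x (mulDx i ω) (d + v (x i)) := by
  intro s
  rw [mulDx_apply]
  split_ifs with hi
  · refine IsWeightedHomogeneous.C_mul ?_ _
    convert hω (s.erase i) using 1
    rw [← Finset.add_sum_erase _ _ hi]
    ring
  · exact isWeightedHomogeneous_zero _ _ _

theorem IsQuasihomogeneous.contrDx (hω : IsQuasihomogeneous v x ω d) (i : Fin n) :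
    IsQuasihomogeneous v x (contrDx i ω) (d - v (x i)) := by
  intro s
  rw [contrDx_apply]
  split_ifs with hi
  · exact isWeightedHomogeneous_zero _ _ _
  · refine IsWeightedHomogeneous.C_mul ?_ _
    convert hω (insert i s) using 1
    rw [Finset.sum_insert hi]
    ring

theorem IsQuasihomogeneous.coeffDeriv (hω : IsQuasihomogeneous v x ω d) (a : τ) :
    IsQuasihomogeneous v x (coeffDeriv a ω) (d - v a) := by
  intro s
  exact (hω s).pderiv (by ring)

theorem IsQuasihomogeneous.extD (hω : IsQuasihomogeneous v x ω d) :
    IsQuasihomogeneous v x (extD x ω) d := by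
  rw [extD_eq_sum]
  refine IsQuasihomogeneous.sum fun i _ => ?_
  convert (hω.coeffDeriv (x i)).mulDx i using 1
  ring

theorem IsQuasihomogeneous.wedgeD (hω : IsQuasihomogeneous v x ω d) {g : MvPolynomial τ ℂ}
    (hg : IsWeightedHomogeneous v g e) : IsQuasihomogeneous v x (wedgeD x g ω) (e + d) := by
  rw [wedgeD_apply]
  refine IsQuasihomogeneous.sum fun i _ => ?_
  convert (hω.mulDx i).poly_smul (hg.pderiv (i := x i) (n' := e - v (x i)) (by ring)) using 1
  ring

theorem IsQuasihomogeneous.contrEuler {w : Fin n → ℚ} {ω : DForm n (Fin n)}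
    (hω : IsQuasihomogeneous w id ω d) : IsQuasihomogeneous w id (contrEuler w ω) d := by
  rw [contrEuler_apply]
  refine IsQuasihomogeneous.sum fun i _ => ?_
  convert (hω.contrDx i).poly_smul ((isWeightedHomogeneous_X ℂ w i).C_mul (w i : ℂ)) using 1
  simp

end Quasihomogeneous

/-! ### Homogeneous components of polynomials and forms. -/

theorem weightedHomogeneousComponent_mul {v : τ → ℚ} {p : MvPolynomial τ ℂ} {a : ℚ}
    (hp : IsWeightedHomogeneous v p a) (q : MvPolynomial τ ℂ) (d : ℚ) :
    weightedHomogeneousComponent v (a + d) (p * q) = p * weightedHomogeneousComponent v d q := by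
  classical
  ext m
  rw [coeff_weightedHomogeneousComponent, coeff_mul, coeff_mul]
  have h : ∀ y ∈ Finset.HasAntidiagonal.antidiagonal m,
      p.coeff y.1 * (weightedHomogeneousComponent v d q).coeff y.2 =
      if Finsupp.weight v m = a + d then p.coeff y.1 * q.coeff y.2 else 0 := by
    intro y hy
    rw [coeff_weightedHomogeneousComponent]
    by_cases hp0 : p.coeff y.1 = 0
    · simp [hp0]
    · have h1 := hp hp0
      rw [← Finset.HasAntidiagonal.mem_antidiagonal.1 hy, map_add, h1]
      simp
  rw [Finset.sum_congr rfl h]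
  split_ifs <;> simp

/-- The component of degree `d` of a form. -/
def formComponent (v : τ → ℚ) (x : Fin n → τ) (d : ℚ) : DForm n τ →ₗ[ℂ] DForm n τ where
  toFun ω := fun s => weightedHomogeneousComponent v (d - ∑ i ∈ s, v (x i)) (ω s)
  map_add' a b := by
    funext s
    simp
  map_smul' c a := by
    funext s
    simp

theorem formComponent_apply (v : τ → ℚ) (x : Fin n → τ) (d : ℚ) (ω : DForm n τ)
    (s : Finset (Fin n)) : formComponent v x d ω s =
      weightedHomogeneousComponent v (d - ∑ i ∈ s, v (x i)) (ω s) := rfl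

theorem isQuasihomogeneous_formComponent (v : τ → ℚ) (x : Fin n → τ) (d : ℚ) (ω : DForm n τ) :
    IsQuasihomogeneous v x (formComponent v x d ω) d := fun _ =>
  weightedHomogeneousComponent_isWeightedHomogeneous _ _

theorem formNorm_formComponent_le (v : τ → ℚ) (x : Fin n → τ) (d : ℚ) (ω : DForm n τ) :
    formNorm (formComponent v x d ω) ≤ formNorm ω :=
  Finset.sum_le_sum fun _ _ => polyNorm_weightedHomogeneousComponent_le _ _ _

theorem formComponent_mem_forms {k : ℕ} (v : τ → ℚ) (x : Fin n → τ) (d : ℚ) {ω : DForm n τ}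
    (hω : ω ∈ forms n τ k) : formComponent v x d ω ∈ forms n τ k := by
  intro s hs
  rw [formComponent_apply, hω s hs, map_zero]

theorem IsQuasihomogeneous.formComponent_eq {v : τ → ℚ} {x : Fin n → τ} {d : ℚ} {ω : DForm n τ}
    (hω : IsQuasihomogeneous v x ω d) : formComponent v x d ω = ω := by
  funext s
  exact (hω s).weightedHomogeneousComponent_same

theorem IsQuasihomogeneous.formComponent_ne {v : τ → ℚ} {x : Fin n → τ} {d e : ℚ} {ω : DForm n τ}
    (hω : IsQuasihomogeneous v x ω e) (h : d ≠ e) : formComponent v x d ω = 0 := by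
  funext s
  exact (hω s).weightedHomogeneousComponent_ne _ (by simpa using h)

theorem formComponent_wedgeD {v : τ → ℚ} {x : Fin n → τ} {g : MvPolynomial τ ℂ} {a : ℚ}
    (hg : IsWeightedHomogeneous v g a) (ω : DForm n τ) (d : ℚ) :
    formComponent v x (a + d) (wedgeD x g ω) = wedgeD x g (formComponent v x d ω) := by
  funext s
  simp only [wedgeD_apply, formComponent_apply, Finset.sum_apply, map_sum, Pi.smul_apply,
    smul_eq_mul, mulDx_apply]
  refine Finset.sum_congr rfl fun i _ => ?_
  split_ifs with hi
  · rw [mul_left_comm, weightedHomogeneousComponent_C_mul, mul_left_comm (pderiv (x i) g),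
      ← weightedHomogeneousComponent_mul
        (hg.pderiv (i := x i) (n' := a - v (x i)) (by ring)) (ω (s.erase i))]
    congr 3
    rw [← Finset.add_sum_erase _ _ hi]
    ring
  · simp

/-! ### Forms without parameters as forms with parameters -/

section Lift

variable {σ : Type}

theorem liftForm_zero : liftForm (n := n) (σ := σ) 0 = 0 := by
  funext s
  simp [liftForm]

theorem liftForm_add (ω η : DForm n (Fin n)) :
    liftForm (σ := σ) (ω + η) = liftForm ω + liftForm η := by
  funext s
  simp [liftForm]

theorem liftForm_poly_smul (g : MvPolynomial (Fin n) ℂ) (ω : DForm n (Fin n)) :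
    liftForm (σ := σ) (g • ω) = (rename Sum.inl g : MvPolynomial (Fin n ⊕ σ) ℂ) • liftForm ω := by
  funext s
  simp [liftForm]

theorem liftForm_smul (c : ℂ) (ω : DForm n (Fin n)) :
    liftForm (σ := σ) (c • ω) = c • liftForm ω := by
  funext s
  simp [liftForm]

theorem liftForm_sum {ι : Type*} (t : Finset ι) (ω : ι → DForm n (Fin n)) :
    liftForm (σ := σ) (∑ i ∈ t, ω i) = ∑ i ∈ t, liftForm (ω i) := by
  funext s
  simp [liftForm]

theorem liftForm_mulDx (i : Fin n) (ω : DForm n (Fin n)) :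
    liftForm (σ := σ) (mulDx i ω) = mulDx i (liftForm ω) := by
  funext s
  simp only [liftForm, mulDx_apply]
  split_ifs <;> simp

theorem liftForm_coeffDeriv (i : Fin n) (ω : DForm n (Fin n)) :
    liftForm (σ := σ) (coeffDeriv i ω) = coeffDeriv (Sum.inl i) (liftForm ω) := by
  funext s
  simp only [liftForm, coeffDeriv_apply]
  exact (pderiv_rename Sum.inl_injective _ _).symm

theorem liftForm_extD (ω : DForm n (Fin n)) :
    liftForm (σ := σ) (extD id ω) = extD Sum.inl (liftForm ω) := by
  simp only [extD_eq_sum, liftForm_sum, liftForm_mulDx, liftForm_coeffDeriv, id_eq]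

theorem liftForm_wedgeD (g : MvPolynomial (Fin n) ℂ) (ω : DForm n (Fin n)) :
    liftForm (σ := σ) (wedgeD id g ω) = wedgeD Sum.inl (rename Sum.inl g) (liftForm ω) := by
  simp only [wedgeD_apply, liftForm_sum, liftForm_poly_smul, liftForm_mulDx, id_eq,
    pderiv_rename Sum.inl_injective]

theorem liftForm_mem_forms {k : ℕ} {ω : DForm n (Fin n)} (hω : ω ∈ forms n (Fin n) k) :
    liftForm (σ := σ) ω ∈ forms n (Fin n ⊕ σ) k := by
  intro s hs
  simp [liftForm, hω s hs]

theorem isWeightedHomogeneous_rename {α β : Type*} {v : β → ℚ} {p : MvPolynomial α ℂ} {d : ℚ}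
    {g : α → β} (hp : IsWeightedHomogeneous (v ∘ g) p d) :
    IsWeightedHomogeneous v (rename g p) d := by
  intro m hm
  obtain ⟨u, rfl, hu⟩ := coeff_rename_ne_zero _ _ _ hm
  rw [← hp hu, Finsupp.weight_apply, Finsupp.weight_apply, Finsupp.sum_mapDomain_index]
  · rfl
  · simp
  · simp [add_smul]

theorem IsQuasihomogeneous.liftForm {w : Fin n → ℚ} {v : σ → ℚ} {ω : DForm n (Fin n)} {d : ℚ}
    (hω : IsQuasihomogeneous w id ω d) :
    IsQuasihomogeneous (Sum.elim w v) Sum.inl (liftForm ω) d := fun s =>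
  isWeightedHomogeneous_rename (v := Sum.elim w v) (hω s)

end Lift

/-! ### Division with quasihomogeneous remainder -/

theorem isQuasihomogeneous_single {τ : Type} {v : τ → ℚ} {x : Fin n → τ} {s : Finset (Fin n)}
    {p : MvPolynomial τ ℂ} {e : ℚ} (hp : IsWeightedHomogeneous v p e) :
    IsQuasihomogeneous v x (Pi.single s p) (e + ∑ i ∈ s, v (x i)) := by
  intro t
  by_cases h : t = s
  · subst h
    simpa using hp
  · rw [Pi.single_eq_of_ne h]
    exact isWeightedHomogeneous_zero _ _ _

theorem isQuasihomogeneous_topMonomial (w : Fin n → ℚ) (α : Fin n →₀ ℕ) :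
    IsQuasihomogeneous w id (topMonomial α) (topDegree w α) :=
  isQuasihomogeneous_single (x := id) (isWeightedHomogeneous_monomial w α 1 rfl)

/-- Since `df ∧` raises degrees by exactly `r`, the degree-`j` component of a division of `μ` is
again a division of `μ`. Taking components discards terms and so increases no norm. -/
theorem exists_quasihomogeneous_division {w : Fin n → ℚ} {r : ℚ} {f : MvPolynomial (Fin n) ℂ}
    (hf : IsWeightedHomogeneous w f r) {l : ℕ} (φ : Fin l → Fin n →₀ ℕ) {μ : DForm n (Fin n)}
    {j : ℚ} (hμ : IsQuasihomogeneous w id μ j) {c : Fin l → ℂ} {η : DForm n (Fin n)}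
    (hη : η ∈ forms n (Fin n) (n - 1))
    (h : μ = ∑ i, c i • topMonomial (φ i) + wedgeD id f η) :
    ∃ (c' : Fin l → ℂ) (η' : DForm n (Fin n)), η' ∈ forms n (Fin n) (n - 1) ∧
      IsQuasihomogeneous w id η' (j - r) ∧
      μ = ∑ i, c' i • topMonomial (φ i) + wedgeD id f η' ∧
      (∀ i, c' i ≠ 0 → topDegree w (φ i) = j) ∧
      formNorm η' ≤ formNorm η ∧ ∀ i, ‖c' i‖ ≤ ‖c i‖ := by
  refine ⟨fun i => if topDegree w (φ i) = j then c i else 0, formComponent w id (j - r) η,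
    formComponent_mem_forms _ _ _ hη, isQuasihomogeneous_formComponent _ _ _ _, ?_, ?_,
    formNorm_formComponent_le _ _ _ _, ?_⟩
  · have e : r + (j - r) = j := by ring
    rw [← formComponent_wedgeD hf, e, ← hμ.formComponent_eq]
    conv_lhs => rw [h]
    rw [map_add, map_sum]
    congr 1
    refine Finset.sum_congr rfl fun i _ => ?_
    rw [map_smul]
    dsimp only
    split_ifs with hi
    · rw [← hi, (isQuasihomogeneous_topMonomial w (φ i)).formComponent_eq]
    · rw [(isQuasihomogeneous_topMonomial w (φ i)).formComponent_ne (Ne.symm hi)]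
      simp
  · intro i hi
    by_contra h
    simp [h] at hi
  · intro i
    dsimp only
    split_ifs <;> simp

theorem euler_decomposition {w : Fin n → ℚ} {r : ℚ} {f : MvPolynomial (Fin n) ℂ}
    (hf : IsWeightedHomogeneous w f r) {l : ℕ} {φ : Fin l → Fin n →₀ ℕ}
    {ω₀ : Fin l → DForm n (Fin n)}
    (hω₀ : ∀ i, IsQuasihomogeneous w id (ω₀ i) (topDegree w (φ i)))
    (hdω₀ : ∀ i, extD id (ω₀ i) = topMonomial (φ i))
    {ω η : DForm n (Fin n)} {j : ℚ} (hj : j ≠ 0) (hω : IsQuasihomogeneous w id ω j)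
    {c : Fin l → ℂ} (hc : ∀ i, c i ≠ 0 → topDegree w (φ i) = j)
    (h : extD id ω = ∑ i, c i • topMonomial (φ i) + wedgeD id f η) :
    ω = ∑ i, c i • ω₀ i + f • ((r / j : ℚ) : ℂ) • η
      - wedgeD id f (((1 / j : ℚ) : ℂ) • contrEuler w η)
      + extD id (((1 / j : ℚ) : ℂ) • (contrEuler w ω - ∑ i, c i • contrEuler w (ω₀ i))) := by
  have hj' : (j : ℂ) ≠ 0 := by exact_mod_cast hj
  have hadj : ∀ (a : ℂ) (θ : DForm n (Fin n)), contrEuler w (a • θ) = a • contrEuler w θ := by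
    intro a θ
    exact LinearMap.map_smul_of_tower _ _ _
  have hadw : ∀ (a : ℂ) (θ : DForm n (Fin n)), wedgeD id f (a • θ) = a • wedgeD id f θ := by
    intro a θ
    exact LinearMap.map_smul_of_tower _ _ _
  have h1 := cartan_euler hω
  rw [h, map_add, map_sum, contrEuler_wedgeD hf] at h1
  -- When `c i ≠ 0` the primitive `ω₀ i` has the same degree `j` as `ω`, so Cartan's formula applies
  -- to it with the same factor.
  have h2 : ∀ i, contrEuler w (c i • topMonomial (φ i)) =
      (j : ℂ) • (c i • ω₀ i) - c i • extD id (contrEuler w (ω₀ i)) := by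
    intro i
    by_cases hi : c i = 0
    · simp [hi]
    · have := cartan_euler (hω₀ i)
      rw [hc i hi, hdω₀] at this
      rw [hadj, eq_sub_of_add_eq this, smul_sub, smul_comm]
  simp only [h2, Finset.sum_sub_distrib, ← Finset.smul_sum] at h1
  have h3 : extD id (((1 / j : ℚ) : ℂ) • (contrEuler w ω - ∑ i, c i • contrEuler w (ω₀ i))) =
      ((1 / j : ℚ) : ℂ) •
        (extD id (contrEuler w ω) - ∑ i, c i • extD id (contrEuler w (ω₀ i))) := by
    simp only [← extDLinear_apply, map_smul, map_sub, map_sum]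
  have h4 : (C (r : ℂ) * f) • η = (r : ℂ) • f • η := by
    funext s
    simp only [Pi.smul_apply, smul_eq_mul, ← C_mul', mul_assoc]
  rw [h4] at h1
  rw [h3, hadw]
  have h5 : f • ((r / j : ℚ) : ℂ) • η = ((r / j : ℚ) : ℂ) • f • η := smul_comm _ _ _
  rw [h5]
  refine smul_right_injective _ hj' ?_
  dsimp only
  rw [← h1]
  simp only [smul_add, smul_sub, smul_smul]
  push_cast
  rw [mul_div_cancel₀ _ hj', mul_one_div_cancel hj']
  simp only [one_smul]
  abel

/-! ### The general semiquasihomogeneous polynomial -/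

theorem generalPoly_eq (w : Fin n → ℚ) (r : ℚ) (f : MvPolynomial (Fin n) ℂ) [Fintype (Param w r)] :
    generalPoly w r f = rename Sum.inl f +
      ∑ s : Param w r, X (Sum.inr s) * rename Sum.inl (monomial s.1 (1 : ℂ)) := by
  rw [generalPoly, finsum_eq_sum_of_fintype]

theorem isWeightedHomogeneous_generalPoly {w : Fin n → ℚ} (hw : ∀ i, 0 < w i) {r : ℚ}
    {f : MvPolynomial (Fin n) ℂ} (hf : IsWeightedHomogeneous w f r) :
    IsWeightedHomogeneous (weightXL w r) (generalPoly w r f) r := by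
  have := finite_param w hw r
  have := Fintype.ofFinite (Param w r)
  rw [generalPoly_eq]
  refine IsWeightedHomogeneous.add (isWeightedHomogeneous_rename (v := weightXL w r) hf)
    (IsWeightedHomogeneous.sum _ _ _ fun s _ => ?_)
  have h1 := (isWeightedHomogeneous_X ℂ (weightXL w r) (Sum.inr s)).mul
    (isWeightedHomogeneous_rename (v := weightXL w r) (g := Sum.inl)
      (isWeightedHomogeneous_monomial w s.1 (1 : ℂ) rfl))
  convert h1 using 1
  simp [weightXL]

/-- The form `ω` of degree `k` is a combination of the forms `ω₀ i` with coefficients in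
`ℂ[F, λ]`, of total norm at most `b`, modulo `dF ∧ Λⁿ⁻²[λ] + dΛⁿ⁻²[λ]`. -/
def Representable (w : Fin n → ℚ) (r : ℚ) (f : MvPolynomial (Fin n) ℂ) {l : ℕ}
    (φ : Fin l → Fin n →₀ ℕ) (ω₀ : Fin l → DForm n (Fin n))
    (ω : DForm n (Fin n ⊕ Param w r)) (k : ℚ) (b : ℝ) : Prop :=
  ∃ (p : Fin l → MvPolynomial (Option (Param w r)) ℂ) (ξ ξ' : DForm n (Fin n ⊕ Param w r)),
    ξ ∈ forms n (Fin n ⊕ Param w r) (n - 2) ∧ ξ' ∈ forms n (Fin n ⊕ Param w r) (n - 2) ∧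
    ω = ∑ i, substF (generalPoly w r f) (p i) • liftForm (ω₀ i) +
      wedgeD Sum.inl (generalPoly w r f) ξ + extD Sum.inl ξ' ∧
    (∀ i, IsWeightedHomogeneous (weightFL w r) (p i) (k - topDegree w (φ i))) ∧
    IsQuasihomogeneous (weightXL w r) Sum.inl ξ (k - r) ∧
    IsQuasihomogeneous (weightXL w r) Sum.inl ξ' k ∧
    ∑ i, polyNorm (p i) ≤ b

namespace Representable

variable {w : Fin n → ℚ} {r : ℚ} {f : MvPolynomial (Fin n) ℂ} {l : ℕ}
  {φ : Fin l → Fin n →₀ ℕ} {ω₀ : Fin l → DForm n (Fin n)}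
  {ω η : DForm n (Fin n ⊕ Param w r)} {k : ℚ} {b b' : ℝ}

theorem mono (h : Representable w r f φ ω₀ ω k b) (hb : b ≤ b') :
    Representable w r f φ ω₀ ω k b' := by
  obtain ⟨p, ξ, ξ', h1, h2, h3, h4, h5, h6, h7⟩ := h
  exact ⟨p, ξ, ξ', h1, h2, h3, h4, h5, h6, h7.trans hb⟩

theorem wedge (ζ : DForm n (Fin n ⊕ Param w r)) (hζ : ζ ∈ forms n (Fin n ⊕ Param w r) (n - 2))
    (hζ' : IsQuasihomogeneous (weightXL w r) Sum.inl ζ (k - r)) :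
    Representable w r f φ ω₀ (wedgeD Sum.inl (generalPoly w r f) ζ) k 0 := by
  refine ⟨0, ζ, 0, hζ, zero_mem _, ?_, fun i => isWeightedHomogeneous_zero _ _ _, hζ',
    isQuasihomogeneous_zero _ _ _, by simp⟩
  simp [← extDLinear_apply]

theorem exact (ζ : DForm n (Fin n ⊕ Param w r)) (hζ : ζ ∈ forms n (Fin n ⊕ Param w r) (n - 2))
    (hζ' : IsQuasihomogeneous (weightXL w r) Sum.inl ζ k) :
    Representable w r f φ ω₀ (extD Sum.inl ζ) k 0 := by
  refine ⟨0, 0, ζ, zero_mem _, hζ, ?_, fun i => isWeightedHomogeneous_zero _ _ _,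
    isQuasihomogeneous_zero _ _ _, hζ', by simp⟩
  simp

theorem zero (k : ℚ) : Representable w r f φ ω₀ 0 k 0 := by
  have := wedge (f := f) (φ := φ) (ω₀ := ω₀) (k := k) (0 : DForm n (Fin n ⊕ Param w r))
    (zero_mem _) (isQuasihomogeneous_zero _ _ _)
  simpa using this

theorem add (h : Representable w r f φ ω₀ ω k b) (h' : Representable w r f φ ω₀ η k b') :
    Representable w r f φ ω₀ (ω + η) k (b + b') := by
  obtain ⟨p, ξ, ξ', h1, h2, h3, h4, h5, h6, h7⟩ := h
  obtain ⟨q, ζ, ζ', h1', h2', h3', h4', h5', h6', h7'⟩ := h'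
  refine ⟨p + q, ξ + ζ, ξ' + ζ', add_mem h1 h1', add_mem h2 h2', ?_,
    fun i => (h4 i).add (h4' i), h5.add h5', h6.add h6', ?_⟩
  · rw [h3, h3', map_add, extD_add]
    simp only [Pi.add_apply, map_add, add_smul, Finset.sum_add_distrib]
    abel
  · refine le_trans ?_ (add_le_add h7 h7')
    rw [← Finset.sum_add_distrib]
    exact Finset.sum_le_sum fun i _ => polyNorm_add_le _ _

theorem sum {ι : Type*} {t : Finset ι} {ω : ι → DForm n (Fin n ⊕ Param w r)} {b : ι → ℝ}
    (h : ∀ i ∈ t, Representable w r f φ ω₀ (ω i) k (b i)) :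
    Representable w r f φ ω₀ (∑ i ∈ t, ω i) k (∑ i ∈ t, b i) := by
  classical
  induction t using Finset.induction_on with
  | empty => simpa using zero k
  | insert a t ha ih =>
    rw [Finset.sum_insert ha, Finset.sum_insert ha]
    exact (h a (Finset.mem_insert_self _ _)).add
      (ih fun i hi => h i (Finset.mem_insert_of_mem hi))

/-- The base terms of the recursion: the coefficient is a constant polynomial, homogeneous of degree
`0`. The degree condition is conditional because coefficients in the wrong degree are zero. -/
theorem smul_base {i : Fin l} (c : ℂ) (hk : c ≠ 0 → topDegree w (φ i) = k) :
    Representable w r f φ ω₀ (liftForm (c • ω₀ i)) k ‖c‖ := by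
  refine ⟨Pi.single i (C c), 0, 0, zero_mem _, zero_mem _, ?_, ?_, isQuasihomogeneous_zero _ _ _,
    isQuasihomogeneous_zero _ _ _, ?_⟩
  · rw [Finset.sum_eq_single i]
    · funext s
      simp [← extDLinear_apply, substF, liftForm, C_mul']
    · intro j _ hj
      simp [hj]
    · simp
  · intro j
    by_cases hj : j = i
    · subst hj
      rw [Pi.single_eq_same]
      by_cases hc : c = 0
      · rw [hc, map_zero]
        exact isWeightedHomogeneous_zero _ _ _
      · rw [hk hc, sub_self]
        exact isWeightedHomogeneous_C _ _
    · rw [Pi.single_eq_of_ne hj]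
      exact isWeightedHomogeneous_zero _ _ _
  · rw [Finset.sum_eq_single i]
    · rw [Pi.single_eq_same, C_apply, polyNorm_monomial]
    · intro j _ hj
      simp [hj]
    · simp

/-- From `F dξ' = d(F ξ') - dF ∧ ξ'`, the pair `(ξ, ξ')` becomes `(F ξ - ξ', F ξ')`. The bound is
unchanged because norms are taken in `ℂ[F, λ]`, where `F` is a variable of norm `1`. -/
theorem generalPoly_smul (hw : ∀ i, 0 < w i) (hf : IsWeightedHomogeneous w f r)
    (h : Representable w r f φ ω₀ ω k b) :
    Representable w r f φ ω₀ (generalPoly w r f • ω) (r + k) b := by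
  have hF := isWeightedHomogeneous_generalPoly hw hf
  obtain ⟨p, ξ, ξ', h1, h2, h3, h4, h5, h6, h7⟩ := h
  refine ⟨fun i => X none * p i, generalPoly w r f • ξ - ξ', generalPoly w r f • ξ',
    sub_mem (poly_smul_mem_forms _ h1) h2, poly_smul_mem_forms _ h2, ?_, ?_, ?_,
    h6.poly_smul hF, ?_⟩
  · rw [extD_poly_smul, h3, map_sub, map_smul]
    simp only [map_mul, smul_add, Finset.smul_sum, mul_smul]
    have : substF (generalPoly w r f) (X none) = generalPoly w r f := by
      simp [substF]
    rw [this]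
    abel
  · intro i
    rw [add_sub_assoc]
    exact (isWeightedHomogeneous_X ℂ (weightFL w r) none).mul (h4 i)
  · have e : r + k - r = k := by ring
    have e' : r + (k - r) = k := by ring
    have := h5.poly_smul hF
    rw [e'] at this
    rw [e, sub_eq_add_neg, ← neg_one_smul ℂ]
    exact this.add (h6.smul _)
  · refine le_trans (Finset.sum_le_sum fun i _ => ?_) h7
    refine (polyNorm_mul_le _ _).trans_eq ?_
    rw [X, polyNorm_monomial]
    simp

theorem pderiv_inl_rename_monomial {σ : Type} (i : Fin n) (a : σ →₀ ℕ) (c : ℂ) :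
    pderiv (Sum.inl i) (rename (Sum.inr : σ → Fin n ⊕ σ) (monomial a c)) = 0 := by
  rw [rename_monomial, pderiv_monomial, Finsupp.mapDomain_of_notMem_range]
  · simp
  · simp

/-- A monomial in the parameters is a constant for `d`, so it multiplies every term of a
representation; its norm is `1`. -/
theorem monomial_smul (a : Param w r →₀ ℕ) (h : Representable w r f φ ω₀ ω k b) :
    Representable w r f φ ω₀ ((rename Sum.inr (monomial a (1 : ℂ)) :
      MvPolynomial (Fin n ⊕ Param w r) ℂ) • ω)
      (Finsupp.weight (fun s : Param w r => r - Finsupp.weight w s.1) a + k) b := by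
  set e := Finsupp.weight (fun s : Param w r => r - Finsupp.weight w s.1) a with he
  have h0 : IsWeightedHomogeneous (fun s : Param w r => r - Finsupp.weight w s.1)
      (monomial a (1 : ℂ)) e := isWeightedHomogeneous_monomial _ _ _ rfl
  have hg : IsWeightedHomogeneous (weightXL w r)
      (rename Sum.inr (monomial a (1 : ℂ)) : MvPolynomial (Fin n ⊕ Param w r) ℂ) e :=
    isWeightedHomogeneous_rename h0
  have hg' : IsWeightedHomogeneous (weightFL w r)
      (rename some (monomial a (1 : ℂ)) : MvPolynomial (Option (Param w r)) ℂ) e :=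
    isWeightedHomogeneous_rename h0
  obtain ⟨p, ξ, ξ', h1, h2, h3, h4, h5, h6, h7⟩ := h
  refine ⟨fun i => rename some (monomial a (1 : ℂ)) * p i,
    (rename Sum.inr (monomial a (1 : ℂ)) : MvPolynomial (Fin n ⊕ Param w r) ℂ) • ξ,
    (rename Sum.inr (monomial a (1 : ℂ)) : MvPolynomial (Fin n ⊕ Param w r) ℂ) • ξ',
    poly_smul_mem_forms _ h1, poly_smul_mem_forms _ h2, ?_, ?_, ?_, h6.poly_smul hg, ?_⟩
  · rw [extD_poly_smul, h3, map_smul]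
    have h8 : substF (generalPoly w r f) (rename some (monomial a (1 : ℂ))) =
        rename Sum.inr (monomial a (1 : ℂ)) := by
      rw [substF, aeval_rename]
      exact DFunLike.congr_fun (algHom_ext fun s => by simp) _
    have h9 : wedgeD (Sum.inl : Fin n → Fin n ⊕ Param w r)
        (rename Sum.inr (monomial a (1 : ℂ)) : MvPolynomial (Fin n ⊕ Param w r) ℂ) ξ' = 0 := by
      rw [wedgeD_apply]
      simp only [pderiv_inl_rename_monomial, zero_smul, Finset.sum_const_zero]
    simp only [map_mul, h8, h9, smul_add, Finset.smul_sum, mul_smul, zero_add]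
  · intro i
    rw [add_sub_assoc]
    exact hg'.mul (h4 i)
  · rw [add_sub_assoc]
    exact h5.poly_smul hg
  · refine le_trans (Finset.sum_le_sum fun i _ => ?_) h7
    refine (polyNorm_mul_le _ _).trans_eq ?_
    rw [rename_monomial, polyNorm_monomial]
    simp

end Representable

/-! ### Reduction of forms without parameters to forms of lower degree -/

/-- The constant `r + ∑ (r + |f_s| n)` that bounds the growth of norms in one reduction step. -/
def reductionConstant (w : Fin n → ℚ) (r : ℚ) : ℝ :=
  r + ∑ᶠ s : Param w r, ((r : ℝ) + (∑ i, (s.1 i : ℝ)) * n)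

/-- This is `f = F - ∑ λ_s f_s` together with `df = dF - ∑ λ_s df_s`. The parameter `λ_s` is written
as a renamed monomial to fit `Representable.monomial_smul`. -/
theorem liftForm_sub_wedgeD (w : Fin n → ℚ) (r : ℚ) (f : MvPolynomial (Fin n) ℂ)
    [Fintype (Param w r)] (η ζ : DForm n (Fin n)) :
    liftForm (f • η - wedgeD id f ζ) =
      generalPoly w r f • liftForm η +
        wedgeD Sum.inl (generalPoly w r f) (liftForm ((-1 : ℂ) • ζ)) +
      ∑ s : Param w r, (rename Sum.inr (monomial (Finsupp.single s 1) (1 : ℂ)) :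
        MvPolynomial (Fin n ⊕ Param w r) ℂ) •
        liftForm (wedgeD id (monomial s.1 1) ζ +
          (-1 : ℂ) • ((monomial s.1 (1 : ℂ) : MvPolynomial (Fin n) ℂ) • η)) := by
  have hX : ∀ s : Param w r, (rename Sum.inr (monomial (Finsupp.single s 1) (1 : ℂ)) :
      MvPolynomial (Fin n ⊕ Param w r) ℂ) = X (Sum.inr s) := by
    intro s
    rw [rename_monomial, Finsupp.mapDomain_single]
    rfl
  have hneg : ∀ θ : DForm n (Fin n), liftForm (σ := Param w r) ((-1 : ℂ) • θ) = -liftForm θ := by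
    intro θ
    rw [liftForm_smul, neg_one_smul]
  have hw : wedgeD Sum.inl (generalPoly w r f) (liftForm ((-1 : ℂ) • ζ)) =
      -(wedgeD Sum.inl (rename Sum.inl f : MvPolynomial (Fin n ⊕ Param w r) ℂ) (liftForm ζ) +
        ∑ s : Param w r, (X (Sum.inr s) : MvPolynomial (Fin n ⊕ Param w r) ℂ) •
          wedgeD Sum.inl (rename Sum.inl (monomial s.1 (1 : ℂ))) (liftForm ζ)) := by
    rw [hneg, map_neg, neg_inj, generalPoly_eq, wedgeD_add]
    congr 1
    simp only [wedgeD_apply, map_sum, Derivation.leibniz, Finset.smul_sum, Finset.sum_smul]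
    rw [Finset.sum_comm]
    refine Finset.sum_congr rfl fun s _ => Finset.sum_congr rfl fun i _ => ?_
    rw [pderiv_X_of_ne (by simp), smul_zero, add_zero, smul_assoc]
  rw [hw, generalPoly_eq, sub_eq_add_neg, ← neg_one_smul ℂ (wedgeD id f ζ)]
  simp only [liftForm_add, hneg, liftForm_wedgeD, liftForm_poly_smul, hX, smul_add,
    Finset.sum_add_distrib, add_smul, Finset.sum_smul, smul_neg, Finset.sum_neg_distrib, mul_smul]
  abel

/-- One reduction step. The norm of `η` enters through `F η₁` with factor `r/j`, and through each
`λ_s`-term with factor `(r + |f_s| n)/j`, where `|f_s|` is the ordinary degree; these factors add up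
to `reductionConstant w r / j`. -/
theorem representable_of_lower {w : Fin n → ℚ} (hn : 2 ≤ n) (hw : ∀ i, 0 < w i)
    (hsum : ∑ i, w i = n) {r : ℚ} (hr : 0 < r)
    {f : MvPolynomial (Fin n) ℂ} (hf : IsWeightedHomogeneous w f r) {l : ℕ}
    {φ : Fin l → Fin n →₀ ℕ} {ω₀ : Fin l → DForm n (Fin n)}
    (hω₀' : ∀ i, ω₀ i ∈ forms n (Fin n) (n - 1))
    (hω₀ : ∀ i, IsQuasihomogeneous w id (ω₀ i) (topDegree w (φ i)))
    (hdω₀ : ∀ i, extD id (ω₀ i) = topMonomial (φ i))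
    {ω η : DForm n (Fin n)} {j : ℚ} (hj : 0 < j) (hω' : ω ∈ forms n (Fin n) (n - 1))
    (hω : IsQuasihomogeneous w id ω j)
    (hη' : η ∈ forms n (Fin n) (n - 1)) (hη : IsQuasihomogeneous w id η (j - r))
    {c : Fin l → ℂ} (hc : ∀ i, c i ≠ 0 → topDegree w (φ i) = j)
    (h : extD id ω = ∑ i, c i • topMonomial (φ i) + wedgeD id f η) {b : ℝ} (hb : 0 ≤ b)
    (ih : ∀ (θ : DForm n (Fin n)) (j' : ℚ), θ ∈ forms n (Fin n) (n - 1) → j' < j →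
      IsQuasihomogeneous w id θ j' →
      Representable w r f φ ω₀ (liftForm θ) j' (b * formNorm θ)) :
    Representable w r f φ ω₀ (liftForm ω) j
      (∑ i, ‖c i‖ + reductionConstant w r / j * b * formNorm η) := by
  have hfin := finite_param w hw r
  have := Fintype.ofFinite (Param w r)
  have hn2 : n - 1 = n - 2 + 1 := by omega
  have hj0 : (0 : ℝ) < j := by exact_mod_cast hj
  set η₁ : DForm n (Fin n) := ((r / j : ℚ) : ℂ) • η with hη₁
  set ζ : DForm n (Fin n) := ((1 / j : ℚ) : ℂ) • contrEuler w η with hζ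
  set ζ' : DForm n (Fin n) :=
    ((1 / j : ℚ) : ℂ) • (contrEuler w ω - ∑ i, c i • contrEuler w (ω₀ i)) with hζ'
  have hdec := euler_decomposition hf hω₀ hdω₀ hj.ne' hω hc h
  rw [← hη₁, ← hζ, ← hζ', add_sub_assoc] at hdec
  have hζmem : ζ ∈ forms n (Fin n) (n - 2) :=
    Submodule.smul_mem _ _ (contrEuler_mem_forms w (hn2 ▸ hη'))
  have hζhom : IsQuasihomogeneous w id ζ (j - r) := hη.contrEuler.smul _
  have hζ'mem : ζ' ∈ forms n (Fin n) (n - 2) :=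
    Submodule.smul_mem _ _ (sub_mem (contrEuler_mem_forms w (hn2 ▸ hω'))
      (sum_mem fun i _ => Submodule.smul_mem _ _ (contrEuler_mem_forms w (hn2 ▸ hω₀' i))))
  have hζ'hom : IsQuasihomogeneous w id ζ' j := by
    refine IsQuasihomogeneous.smul ?_ _
    rw [sub_eq_add_neg, ← neg_one_smul ℂ]
    refine hω.contrEuler.add (IsQuasihomogeneous.smul (IsQuasihomogeneous.sum fun i _ => ?_) _)
    by_cases hi : c i = 0
    · rw [hi, zero_smul]
      exact isQuasihomogeneous_zero _ _ _
    · rw [← hc i hi]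
      exact (hω₀ i).contrEuler.smul _
  have hη₁norm : formNorm η₁ = (r / j : ℝ) * formNorm η := by
    have : (0 : ℝ) < r / j := by
      have : (0 : ℝ) < r := by exact_mod_cast hr
      positivity
    rw [hη₁, formNorm_smul]
    push_cast
    rw [← Complex.ofReal_ratCast, ← Complex.ofReal_ratCast, ← Complex.ofReal_div,
      Complex.norm_real, Real.norm_of_nonneg this.le]
  -- Contraction with the Euler field costs the sum of the weights, which is normalised to `n`.
  have hζnorm : formNorm ζ ≤ (n / j : ℝ) * formNorm η := by
    have h0 : (0 : ℝ) < 1 / j := by positivity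
    rw [hζ, formNorm_smul]
    push_cast
    rw [← Complex.ofReal_ratCast, ← Complex.ofReal_one, ← Complex.ofReal_div,
      Complex.norm_real, Real.norm_of_nonneg h0.le]
    have h1 := formNorm_contrEuler_le hw η
    rw [hsum] at h1
    calc (1 / j : ℝ) * formNorm (contrEuler w η) ≤ (1 / j : ℝ) * (((n : ℚ) : ℝ) * formNorm η) :=
          mul_le_mul_of_nonneg_left h1 h0.le
      _ = (n / j : ℝ) * formNorm η := by
          push_cast
          ring
  have hη₁rep : Representable w r f φ ω₀ (generalPoly w r f • liftForm η₁) j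
      (b * ((r / j : ℝ) * formNorm η)) := by
    have := (ih η₁ (j - r) (Submodule.smul_mem _ _ hη') (by linarith) (hη.smul _)).generalPoly_smul
      hw hf
    rw [hη₁norm] at this
    convert this using 1
    ring
  have hsrep : ∀ s : Param w r, Representable w r f φ ω₀
      ((rename Sum.inr (monomial (Finsupp.single s 1) (1 : ℂ)) :
        MvPolynomial (Fin n ⊕ Param w r) ℂ) •
        liftForm (wedgeD id (monomial s.1 1) ζ +
          (-1 : ℂ) • ((monomial s.1 (1 : ℂ) : MvPolynomial (Fin n) ℂ) • η₁))) j
      (b * (((r : ℝ) + (∑ i, (s.1 i : ℝ)) * n) / j * formNorm η)) := by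
    intro s
    have hs := isWeightedHomogeneous_monomial w s.1 (1 : ℂ) rfl
    have hs' := s.2
    have hmem : wedgeD id (monomial s.1 1) ζ +
        (-1 : ℂ) • ((monomial s.1 (1 : ℂ) : MvPolynomial (Fin n) ℂ) • η₁) ∈
        forms n (Fin n) (n - 1) := by
      refine add_mem ?_ (Submodule.smul_mem _ _
        (poly_smul_mem_forms _ (Submodule.smul_mem _ _ hη')))
      rw [hn2]
      exact wedgeD_mem_forms _ _ hζmem
    have hhom : IsQuasihomogeneous w id (wedgeD id (monomial s.1 1) ζ +
        (-1 : ℂ) • ((monomial s.1 (1 : ℂ) : MvPolynomial (Fin n) ℂ) • η₁))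
        (Finsupp.weight w s.1 + (j - r)) :=
      (hζhom.wedgeD hs).add (((hη.smul _).poly_smul hs).smul _)
    -- Without `λ_s` the form has degree `deg f_s + j - r < j`; the weight `r - deg f_s` of `λ_s`
    -- brings it back to `j`.
    have := (ih _ _ hmem (by linarith) hhom).monomial_smul (Finsupp.single s 1)
    rw [Finsupp.weight_single, one_smul] at this
    have e : r - Finsupp.weight w s.1 + (Finsupp.weight w s.1 + (j - r)) = j := by ring
    rw [e] at this
    refine this.mono (mul_le_mul_of_nonneg_left ?_ hb)
    refine (formNorm_add_le _ _).trans ?_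
    have h1 : formNorm (wedgeD id (monomial s.1 1) ζ) ≤
        (∑ i, (s.1 i : ℝ)) * ((n / j : ℝ) * formNorm η) := by
      refine (formNorm_wedgeD_le _ _ _).trans ?_
      refine mul_le_mul ?_ hζnorm (formNorm_nonneg _) (Finset.sum_nonneg fun _ _ => by positivity)
      refine (sum_polyNorm_pderiv_le (b := ∑ i, (s.1 i : ℝ)) ?_).trans_eq (by simp)
      intro m hm
      rw [Finset.mem_singleton.1 (support_monomial_subset hm)]
    have h2 : formNorm ((-1 : ℂ) • ((monomial s.1 (1 : ℂ) : MvPolynomial (Fin n) ℂ) • η₁)) ≤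
        (r / j : ℝ) * formNorm η := by
      rw [formNorm_smul, norm_neg, norm_one, one_mul, ← hη₁norm]
      refine (formNorm_poly_smul_le _ _).trans_eq ?_
      simp
    refine (add_le_add h1 h2).trans_eq ?_
    ring
  have hcrep : Representable w r f φ ω₀ (∑ i, liftForm (c i • ω₀ i)) j (∑ i, ‖c i‖) :=
    Representable.sum fun i _ => Representable.smul_base (c i) (hc i)
  have hwrep : Representable w r f φ ω₀ (wedgeD Sum.inl (generalPoly w r f)
      (liftForm ((-1 : ℂ) • ζ))) j 0 :=
    Representable.wedge _ (liftForm_mem_forms (Submodule.smul_mem _ _ hζmem))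
      (hζhom.smul _).liftForm
  have hxrep : Representable w r f φ ω₀ (extD Sum.inl (liftForm ζ')) j 0 :=
    Representable.exact _ (liftForm_mem_forms hζ'mem) hζ'hom.liftForm
  have htotal := (hcrep.add ((hη₁rep.add hwrep).add
    (Representable.sum fun s _ => hsrep s : Representable w r f φ ω₀ (∑ s : Param w r, _) j _))).add
      hxrep
  rw [hdec, liftForm_add, liftForm_add, liftForm_sum, liftForm_extD, liftForm_sub_wedgeD]
  refine htotal.mono (le_of_eq ?_)
  rw [reductionConstant, finsum_eq_sum_of_fintype, ← Finset.mul_sum, ← Finset.sum_mul,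
    ← Finset.sum_div]
  ring

/-! ### Induction on the degree -/

/-- Clearing denominators makes `q` times the degree of any monomial form a natural number, on which
one can induct. -/
theorem exists_nat_eq_mul_weight {w : Fin n → ℚ} {q : ℕ} (hq : ∀ i, ∃ m : ℕ, q * w i = m)
    (α : Fin n →₀ ℕ) (s : Finset (Fin n)) :
    ∃ m : ℕ, q * (Finsupp.weight w α + ∑ i ∈ s, w i) = m := by
  choose m hm using hq
  refine ⟨∑ i, α i * m i + ∑ i ∈ s, m i, ?_⟩
  rw [Finsupp.weight_eq_sum]
  push_cast
  rw [mul_add, Finset.mul_sum, Finset.mul_sum]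
  congr 1
  · refine Finset.sum_congr rfl fun i _ => ?_
    rw [← hm i, nsmul_eq_mul]
    ring
  · exact Finset.sum_congr rfl fun i _ => hm i

theorem exists_degree_of_ne_zero {τ : Type} {v : τ → ℚ} {x : Fin n → τ} {ω : DForm n τ} {j : ℚ}
    {k : ℕ} (hω : IsQuasihomogeneous v x ω j) (hω' : ω ∈ forms n τ k) (h : ω ≠ 0) :
    ∃ (α : τ →₀ ℕ) (s : Finset (Fin n)), s.card = k ∧
      j = Finsupp.weight v α + ∑ i ∈ s, v (x i) := by
  obtain ⟨s, hs⟩ := Function.ne_iff.1 h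
  obtain ⟨α, hα⟩ := MvPolynomial.ne_zero_iff.1 hs
  refine ⟨α, s, ?_, ?_⟩
  · by_contra hc
    exact hs (hω' s hc)
  · rw [hω s hα]
    ring

theorem weight_nonneg {τ : Type} {v : τ → ℚ} (hv : ∀ i, 0 < v i) (α : τ →₀ ℕ) :
    0 ≤ Finsupp.weight v α := by
  rw [Finsupp.weight_apply]
  exact Finset.sum_nonneg fun i _ => nsmul_nonneg (hv i).le _

/-- The division with remainder by `df`, in terms of `wedgeD`. -/
theorem IsDivisionConstant.exists_division {w : Fin n → ℚ} {r : ℚ} {f : MvPolynomial (Fin n) ℂ}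
    (hf : IsWeightedHomogeneous w f r) {l : ℕ} {φ : Fin l → Fin n →₀ ℕ} {M : ℝ}
    (hM : IsDivisionConstant w r f φ M) {μ : DForm n (Fin n)} (hμ' : μ ∈ forms n (Fin n) n)
    {j : ℚ} (hμ : IsQuasihomogeneous w id μ j) :
    ∃ (c : Fin l → ℂ) (η : DForm n (Fin n)), η ∈ forms n (Fin n) (n - 1) ∧
      IsQuasihomogeneous w id η (j - r) ∧
      μ = ∑ i, c i • topMonomial (φ i) + wedgeD id f η ∧
      (∀ i, c i ≠ 0 → topDegree w (φ i) = j) ∧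
      formNorm η + ∑ i, ‖c i‖ ≤ M * formNorm μ := by
  obtain ⟨c, η, h1, h2, -, h3⟩ := hM μ hμ'
  rw [wedge_extD_ofFun] at h2
  obtain ⟨c', η', h4, h5, h6, h7, h8, h9⟩ := exists_quasihomogeneous_division hf φ hμ h1 h2
  exact ⟨c', η', h4, h5, h6, h7, (add_le_add h8 (Finset.sum_le_sum fun i _ => h9 i)).trans h3⟩

/-- Strong induction on `ν = q j`. The majorant `B` has to dominate the direct terms `c_i` (`hB1`)
and the recursion (`hB2`), but only for `ν ≥ q (n-1) w₀`: a nonzero `(n-1)`-form contains `n-1`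
differentials of weight at least `w₀`. The symmetric bound relies on this restriction. -/
theorem representable_liftForm {w : Fin n → ℚ} (hn : 2 ≤ n) (hw : ∀ i, 0 < w i)
    (hsum : ∑ i, w i = n) {r : ℚ} (hr : 0 < r)
    {f : MvPolynomial (Fin n) ℂ} (hf : IsWeightedHomogeneous w f r) {l : ℕ}
    {φ : Fin l → Fin n →₀ ℕ} {ω₀ : Fin l → DForm n (Fin n)}
    (hω₀' : ∀ i, ω₀ i ∈ forms n (Fin n) (n - 1))
    (hω₀ : ∀ i, IsQuasihomogeneous w id (ω₀ i) (topDegree w (φ i)))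
    (hdω₀ : ∀ i, extD id (ω₀ i) = topMonomial (φ i))
    {q : ℕ} (hq : 0 < q) (hqw : ∀ i, ∃ m : ℕ, q * w i = m) {w₀ : ℚ} (hw₀ : 0 < w₀)
    (hw₀' : ∀ i, w₀ ≤ w i) {M : ℝ} (hM0 : 0 ≤ M) (hM : IsDivisionConstant w r f φ M)
    {B : ℕ → ℝ} (hB0 : ∀ ν, 0 ≤ B ν) (hBmono : Monotone B) {N : ℕ}
    (hB1 : ∀ ν ≤ N, (q * ((n - 1 : ℕ) * w₀) : ℚ) ≤ ν → M * (ν / q / w₀) ≤ B ν)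
    (hB2 : ∀ ν ≤ N, (q * ((n - 1 : ℕ) * w₀) : ℚ) ≤ ν →
      M * (reductionConstant w r / w₀) * B (ν - 1) ≤ B ν)
    (ν : ℕ) (hν : ν ≤ N) (ω : DForm n (Fin n)) (j : ℚ) (hω' : ω ∈ forms n (Fin n) (n - 1))
    (hω : IsQuasihomogeneous w id ω j) (hj : q * j = ν) :
    Representable w r f φ ω₀ (liftForm ω) j (B ν * formNorm ω) := by
  induction ν using Nat.strong_induction_on generalizing ω j with
  | _ ν ih =>
  have hq' : (0 : ℚ) < q := by exact_mod_cast hq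
  by_cases hω_ne : ω = 0
  · subst hω_ne
    rw [liftForm_zero, formNorm_zero, mul_zero]
    exact Representable.zero _
  obtain ⟨α, s, hs, hjs⟩ := exists_degree_of_ne_zero hω hω' hω_ne
  have hjlow : ((n - 1 : ℕ) * w₀ : ℚ) ≤ j := by
    have h1 : (s.card : ℚ) * w₀ ≤ ∑ i ∈ s, w i := by
      rw [← nsmul_eq_mul]
      exact Finset.card_nsmul_le_sum _ _ _ fun i _ => hw₀' i
    have := weight_nonneg hw α
    rw [hs] at h1
    simp only [id] at hjs
    linarith
  have hn1 : (0 : ℚ) < (n - 1 : ℕ) := by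
    have : 0 < n - 1 := by omega
    exact_mod_cast this
  have hj0 : 0 < j := lt_of_lt_of_le (by positivity) hjlow
  have hνlow : (q * ((n - 1 : ℕ) * w₀) : ℚ) ≤ ν := by
    rw [← hj]
    exact mul_le_mul_of_nonneg_left hjlow hq'.le
  have hn' : n - 1 + 1 = n := by omega
  have hdω : extD id ω ∈ forms n (Fin n) n := by
    have := extD_mem_forms id hω'
    rwa [hn'] at this
  obtain ⟨c, η, hη', hη, hdiv, hc, hnorm⟩ :=
    hM.exists_division hf hdω hω.extD
  have hstep := representable_of_lower hn hw hsum hr hf hω₀' hω₀ hdω₀ hj0 hω' hω hη' hη hc hdiv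
    (hB0 (ν - 1)) ?_
  · refine hstep.mono ?_
    have hjR : (0 : ℝ) < j := by exact_mod_cast hj0
    have hw₀R : (0 : ℝ) < w₀ := by exact_mod_cast hw₀
    have hjν : (j : ℝ) = ν / q := by
      rw [eq_div_iff (by positivity), mul_comm]
      exact_mod_cast hj
    -- Every variable has weight at least `w₀`, so a coefficient of weight at most `j` has ordinary
    -- degree at most `j / w₀`.
    have hd : formNorm (extD id ω) ≤ (j / w₀ : ℝ) * formNorm ω := by
      refine formNorm_extD_le fun t m hm => ?_
      rw [le_div_iff₀ hw₀R]
      have h1 := hω t (mem_support_iff.1 hm)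
      rw [Finsupp.weight_eq_sum] at h1
      have h2 : (∑ i, (m i : ℚ)) * w₀ ≤ j := by
        have h3 : 0 ≤ ∑ i ∈ t, w (id i) := Finset.sum_nonneg fun i _ => (hw _).le
        have h4 : (∑ i, (m i : ℚ)) * w₀ ≤ ∑ i, m i • w i := by
          rw [Finset.sum_mul]
          refine Finset.sum_le_sum fun i _ => ?_
          rw [nsmul_eq_mul]
          exact mul_le_mul_of_nonneg_left (hw₀' i) (by positivity)
        linarith
      exact_mod_cast h2
    have hD : formNorm η + ∑ i, ‖c i‖ ≤ M * ((j / w₀ : ℝ) * formNorm ω) :=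
      hnorm.trans (mul_le_mul_of_nonneg_left hd hM0)
    set G := reductionConstant w r with hG
    -- Division bounds only the sum `‖η‖ + ∑ |c_i|`, so both parts are charged at the larger rate.
    -- After multiplication by `j / w₀` the two entries of the maximum are the left-hand sides of
    -- `hB1` and `hB2`; in the second one `j` cancels.
    set m := max 1 (G / j * B (ν - 1)) with hm
    have h1 : ∑ i, ‖c i‖ + G / j * B (ν - 1) * formNorm η ≤ m * (formNorm η + ∑ i, ‖c i‖) := by
      rw [mul_add, add_comm]
      refine add_le_add (mul_le_mul_of_nonneg_right (le_max_right _ _) (formNorm_nonneg _)) ?_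
      exact le_mul_of_one_le_left (Finset.sum_nonneg fun _ _ => norm_nonneg _) (le_max_left _ _)
    refine h1.trans ((mul_le_mul_of_nonneg_left hD (zero_le_one.trans (le_max_left _ _))).trans ?_)
    rw [← mul_assoc, ← mul_assoc]
    refine mul_le_mul_of_nonneg_right ?_ (formNorm_nonneg _)
    rw [mul_assoc, max_mul_of_nonneg _ _ (by positivity)]
    refine max_le ?_ ?_
    · rw [one_mul, hjν]
      exact hB1 ν hν hνlow
    · refine le_trans (le_of_eq ?_) (hB2 ν hν hνlow)
      field_simp
  · intro θ j' hθ' hj' hθ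
    by_cases hθ_ne : θ = 0
    · subst hθ_ne
      rw [liftForm_zero, formNorm_zero, mul_zero]
      exact Representable.zero _
    obtain ⟨α', s', -, hjs'⟩ := exists_degree_of_ne_zero hθ hθ' hθ_ne
    obtain ⟨ν', hν'⟩ := exists_nat_eq_mul_weight hqw α' s'
    have hν'' : q * j' = ν' := by
      rw [hjs', ← hν']
      rfl
    -- A smaller degree means an integer `ν' ≤ ν - 1`, and monotonicity of `B` gives the single
    -- bound `B (ν - 1)`.
    have hlt : ν' < ν := by
      have : (ν' : ℚ) < ν := by
        rw [← hν'', ← hj]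
        exact mul_lt_mul_of_pos_left hj' hq'
      exact_mod_cast this
    refine (ih ν' hlt (hlt.le.trans hν) θ j' hθ' hθ hν'').mono ?_
    exact mul_le_mul_of_nonneg_right (hBmono (by omega)) (formNorm_nonneg _)

/-- The norm is additive over monomials, so it suffices to treat `c λ^β x^α dx_s`, that is, `λ^β`
times a form without parameters. -/
theorem representable_of_isQuasihomogeneous {w : Fin n → ℚ} (hn : 2 ≤ n) (hw : ∀ i, 0 < w i)
    (hsum : ∑ i, w i = n) {r : ℚ} (hr : 0 < r)
    {f : MvPolynomial (Fin n) ℂ} (hf : IsWeightedHomogeneous w f r) {l : ℕ}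
    {φ : Fin l → Fin n →₀ ℕ} {ω₀ : Fin l → DForm n (Fin n)}
    (hω₀' : ∀ i, ω₀ i ∈ forms n (Fin n) (n - 1))
    (hω₀ : ∀ i, IsQuasihomogeneous w id (ω₀ i) (topDegree w (φ i)))
    (hdω₀ : ∀ i, extD id (ω₀ i) = topMonomial (φ i))
    {q : ℕ} (hq : 0 < q) (hqw : ∀ i, ∃ m : ℕ, q * w i = m) {w₀ : ℚ} (hw₀ : 0 < w₀)
    (hw₀' : ∀ i, w₀ ≤ w i) {M : ℝ} (hM0 : 0 ≤ M) (hM : IsDivisionConstant w r f φ M) {k : ℚ}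
    {B : ℕ → ℝ} (hB0 : ∀ ν, 0 ≤ B ν) (hBmono : Monotone B)
    (hB1 : ∀ ν ≤ ⌊q * k⌋₊, (q * ((n - 1 : ℕ) * w₀) : ℚ) ≤ ν → M * (ν / q / w₀) ≤ B ν)
    (hB2 : ∀ ν ≤ ⌊q * k⌋₊, (q * ((n - 1 : ℕ) * w₀) : ℚ) ≤ ν →
      M * (reductionConstant w r / w₀) * B (ν - 1) ≤ B ν)
    (ω : DForm n (Fin n ⊕ Param w r)) (hω' : ω ∈ forms n (Fin n ⊕ Param w r) (n - 1))
    (hω : IsQuasihomogeneous (weightXL w r) Sum.inl ω k) :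
    Representable w r f φ ω₀ ω k (B ⌊q * k⌋₊ * formNorm ω) := by
  have hq' : (0 : ℚ) < q := by exact_mod_cast hq
  have key : ∀ (s : Finset (Fin n)) (m : Fin n ⊕ Param w r →₀ ℕ), m ∈ (ω s).support →
      Representable w r f φ ω₀ (Pi.single s (monomial m ((ω s).coeff m))) k
        (B ⌊q * k⌋₊ * ‖(ω s).coeff m‖) := by
    intro s m hm
    have hs : s.card = n - 1 := by
      by_contra hs
      rw [hω' s hs] at hm
      simp at hm
    obtain ⟨⟨α, β⟩, hαβ⟩ := Finsupp.sumFinsuppEquivProdFinsupp.symm.surjective m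
    set c := (ω s).coeff m with hc
    have hm' : m = α.mapDomain Sum.inl + β.mapDomain Sum.inr := by
      rw [← hαβ]
      ext x
      rcases x with i | i
      · rw [Finsupp.add_apply, Finsupp.mapDomain_apply Sum.inl_injective,
          Finsupp.mapDomain_of_notMem_range _ _ (by simp)]
        simp
      · rw [Finsupp.add_apply, Finsupp.mapDomain_apply Sum.inr_injective,
          Finsupp.mapDomain_of_notMem_range _ _ (by simp)]
        simp
    have hform : (Pi.single s (monomial m c) : DForm n (Fin n ⊕ Param w r)) =
        (rename Sum.inr (monomial β (1 : ℂ)) : MvPolynomial (Fin n ⊕ Param w r) ℂ) •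
          liftForm (Pi.single s (monomial α c)) := by
      funext t
      rw [Pi.smul_apply, liftForm]
      by_cases ht : t = s
      · subst ht
        rw [Pi.single_eq_same, Pi.single_eq_same, rename_monomial, rename_monomial, smul_eq_mul,
          monomial_mul, one_mul, hm', add_comm]
      · rw [Pi.single_eq_of_ne ht, Pi.single_eq_of_ne ht]
        simp
    set j := Finsupp.weight w α + ∑ i ∈ s, w i with hj
    have hk : k = Finsupp.weight (fun s : Param w r => r - Finsupp.weight w s.1) β + j := by
      have h1 := hω s (mem_support_iff.1 hm)
      have h2 : Finsupp.weight (weightXL w r) m = Finsupp.weight w α +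
          Finsupp.weight (fun s : Param w r => r - Finsupp.weight w s.1) β := by
        rw [hm', map_add, Finsupp.weight_apply, Finsupp.weight_apply,
          Finsupp.sum_mapDomain_index (by simp) (by simp [add_smul]),
          Finsupp.sum_mapDomain_index (by simp) (by simp [add_smul])]
        rfl
      rw [h2] at h1
      have h3 : ∑ i ∈ s, weightXL w r (Sum.inl i) = ∑ i ∈ s, w i := rfl
      rw [h3] at h1
      linarith
    obtain ⟨ν, hν⟩ := exists_nat_eq_mul_weight hqw α s
    -- The parameters have positive weight, so removing `λ^β` cannot raise the degree.
    have hjk : j ≤ k := by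
      have : 0 ≤ Finsupp.weight (fun s : Param w r => r - Finsupp.weight w s.1) β :=
        weight_nonneg (fun s => sub_pos.2 s.2) β
      linarith
    have hνk : ν ≤ ⌊q * k⌋₊ := by
      refine Nat.le_floor ?_
      rw [← hν]
      exact mul_le_mul_of_nonneg_left hjk hq'.le
    have hmem : (Pi.single s (monomial α c) : DForm n (Fin n)) ∈ forms n (Fin n) (n - 1) := by
      intro t ht
      rw [Pi.single_eq_of_ne]
      rintro rfl
      exact ht hs
    have hhom : IsQuasihomogeneous w id (Pi.single s (monomial α c)) j :=
      isQuasihomogeneous_single (x := id) (isWeightedHomogeneous_monomial w α c rfl)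
    have := (representable_liftForm hn hw hsum hr hf hω₀' hω₀ hdω₀ hq hqw hw₀ hw₀' hM0 hM hB0
      hBmono hB1 hB2 ν hνk _ j hmem hhom hν).monomial_smul β
    rw [← hform, ← hk, formNorm_single, polyNorm_monomial] at this
    exact this.mono (mul_le_mul_of_nonneg_right (hBmono hνk) (norm_nonneg _))
  have hsumω : ω = ∑ s, ∑ m ∈ (ω s).support, Pi.single s (monomial m ((ω s).coeff m)) := by
    have h1 : ∀ s, ∑ m ∈ (ω s).support, (Pi.single s (monomial m ((ω s).coeff m)) :
        DForm n (Fin n ⊕ Param w r)) = Pi.single s (ω s) := by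
      intro s
      conv_rhs => rw [(ω s).as_sum]
      exact (map_sum (AddMonoidHom.single (fun _ => MvPolynomial (Fin n ⊕ Param w r) ℂ) s)
        _ _).symm
    simp only [h1]
    exact (Finset.univ_sum_single ω).symm
  have := Representable.sum (t := Finset.univ) fun s _ =>
    Representable.sum fun m hm => key s m hm
  rw [← hsumω] at this
  refine this.mono (le_of_eq ?_)
  rw [formNorm, Finset.mul_sum]
  refine Finset.sum_congr rfl fun s _ => ?_
  rw [polyNorm, Finset.mul_sum]

/-! ### The Jacobian ideal -/

/-- The ideal generated by the partial derivatives of `f`. -/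
def jacobianIdeal (f : MvPolynomial (Fin n) ℂ) : Ideal (MvPolynomial (Fin n) ℂ) :=
  Ideal.span (Set.range fun i => pderiv i f)

theorem eq_single_univ {τ : Type} {μ : DForm n τ} (hμ : μ ∈ forms n τ n) :
    μ = Pi.single Finset.univ (μ Finset.univ) := by
  funext s
  by_cases hs : s = Finset.univ
  · subst hs
    simp
  · rw [Pi.single_eq_of_ne hs, hμ s]
    intro h
    exact hs (Finset.card_eq_iff_eq_univ s |>.1 (by simpa using h))

theorem wedgeD_univ (f : MvPolynomial (Fin n) ℂ) (η : DForm n (Fin n)) :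
    wedgeD id f η Finset.univ =
      ∑ i, (C (dxSign i Finset.univ) * η (Finset.univ.erase i)) * pderiv i f := by
  rw [wedgeD_apply, Finset.sum_apply]
  refine Finset.sum_congr rfl fun i _ => ?_
  simp [mulDx_apply, mul_comm]

/-- If `h = ∑ g_i ∂_i f`, the `g_i` with the signs `dxSign` are the coefficients of `η`. Division by
`df` is thus division modulo the Jacobian ideal. -/
theorem exists_wedgeD_eq_single (hn : 1 ≤ n) {f h : MvPolynomial (Fin n) ℂ}
    (hh : h ∈ jacobianIdeal f) : ∃ η ∈ forms n (Fin n) (n - 1),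
      wedgeD id f η = Pi.single Finset.univ h := by
  obtain ⟨g, hg⟩ := Ideal.mem_span_range_iff_exists_fun.1 hh
  obtain ⟨η, hη⟩ : ∃ η : DForm n (Fin n), η =
      ∑ i, Pi.single (Finset.univ.erase i) (C (dxSign i Finset.univ) * g i) := ⟨_, rfl⟩
  have hmem : η ∈ forms n (Fin n) (n - 1) := by
    rw [hη]
    refine sum_mem fun i _ s hs => ?_
    rw [Pi.single_eq_of_ne]
    rintro rfl
    exact hs (by simp)
  have hcoeff : ∀ i, η (Finset.univ.erase i) = C (dxSign i Finset.univ) * g i := by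
    intro i
    rw [hη, Finset.sum_apply, Finset.sum_eq_single i]
    · rw [Pi.single_eq_same]
    · intro j _ hj
      rw [Pi.single_eq_of_ne]
      intro h
      have : j ∉ Finset.univ.erase i := h ▸ Finset.notMem_erase j _
      exact this (by simp [hj])
    · simp
  have h1 := wedgeD_mem_forms id f hmem
  rw [Nat.sub_add_cancel hn] at h1
  refine ⟨η, hmem, ?_⟩
  rw [eq_single_univ h1, wedgeD_univ, ← hg]
  refine congrArg _ (Finset.sum_congr rfl fun i _ => ?_)
  rw [hcoeff, ← mul_assoc, ← C_mul, dxSign_mul_self, C_1, one_mul]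

theorem wedgeD_univ_mem (f : MvPolynomial (Fin n) ℂ) (η : DForm n (Fin n)) :
    wedgeD id f η Finset.univ ∈ jacobianIdeal f := by
  rw [wedgeD_univ]
  exact sum_mem fun i _ => Ideal.mul_mem_left _ _ (Ideal.subset_span ⟨i, rfl⟩)

/-! ### The torus action and the critical points of `f`. -/

theorem eval_eq_pow_mul {w : Fin n → ℚ} {q : ℕ} {m : Fin n → ℕ} (hm : ∀ i, q * w i = m i)
    {p : MvPolynomial (Fin n) ℂ} {d : ℚ} (hp : IsWeightedHomogeneous w p d) (t : ℂ)
    (a : Fin n → ℂ) : eval (fun i => t ^ m i * a i) p = t ^ ⌊q * d⌋₊ * eval a p := by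
  rw [eval_eq', eval_eq', Finset.mul_sum]
  refine Finset.sum_congr rfl fun α hα => ?_
  -- On the support `q * d` is itself a natural number, so the floor loses nothing; for `p = 0`
  -- there is no such `α`.
  have h1 : ∑ i, m i * α i = ⌊q * d⌋₊ := by
    have h2 : (q * d : ℚ) = (∑ i, m i * α i : ℕ) := by
      rw [← hp (mem_support_iff.1 hα), Finsupp.weight_eq_sum, Finset.mul_sum]
      push_cast
      refine Finset.sum_congr rfl fun i _ => ?_
      rw [← hm, nsmul_eq_mul]
      ring
    rw [h2, Nat.floor_natCast]
  simp only [mul_pow, Finset.prod_mul_distrib, ← pow_mul]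
  rw [Finset.prod_pow_eq_pow_sum, h1]
  ring

theorem exists_common_denominator {w : Fin n → ℚ} (hw : ∀ i, 0 < w i) :
    ∃ q : ℕ, 0 < q ∧ ∀ i, ∃ m : ℕ, q * w i = m := by
  refine ⟨∏ i, (w i).den, Finset.prod_pos fun i _ => (w i).den_pos, fun i => ?_⟩
  refine ⟨(∏ j ∈ Finset.univ.erase i, (w j).den) * (w i).num.toNat, ?_⟩
  rw [← Finset.mul_prod_erase _ _ (Finset.mem_univ i)]
  have h1 : ((w i).num.toNat : ℚ) = (w i).num := by
    have := Int.toNat_of_nonneg (Rat.num_nonneg.2 (hw i).le)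
    exact_mod_cast this
  push_cast
  rw [h1, ← Rat.mul_den_eq_num (w i)]
  ring

/-- The critical set is invariant under `a_i ↦ t^(m_i) a_i`. A critical point `a ≠ 0` would yield
nonzero critical points tending to `0` with `t`, against isolatedness. -/
theorem exists_pderiv_ne_zero {w : Fin n → ℚ} (hw : ∀ i, 0 < w i) {r : ℚ}
    {f : MvPolynomial (Fin n) ℂ} (hf : IsWeightedHomogeneous w f r)
    (hcrit : HasIsolatedCriticalPoint f) {a : Fin n → ℂ} (ha : a ≠ 0) :
    ∃ i, eval a (pderiv i f) ≠ 0 := by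
  obtain ⟨q, hq, hqw⟩ := exists_common_denominator hw
  choose m hm using hqw
  have hm0 : ∀ i, m i ≠ 0 := by
    intro i h
    have h1 := hm i
    rw [h] at h1
    have : (0 : ℚ) < q * w i := mul_pos (by exact_mod_cast hq) (hw i)
    rw [h1] at this
    simp at this
  have htend : Tendsto (fun (t : ℂ) (i : Fin n) => t ^ m i * a i) (𝓝[≠] 0) (𝓝[≠] 0) := by
    refine tendsto_nhdsWithin_iff.2 ⟨?_, ?_⟩
    · have hc : Continuous fun (t : ℂ) (i : Fin n) => t ^ m i * a i := by fun_prop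
      have := hc.tendsto 0
      have h0 : (fun i : Fin n => (0 : ℂ) ^ m i * a i) = 0 := by
        funext i
        simp [hm0 i]
      rw [h0] at this
      exact this.mono_left nhdsWithin_le_nhds
    · filter_upwards [self_mem_nhdsWithin] with t ht
      obtain ⟨i, hi⟩ := Function.ne_iff.1 ha
      refine Function.ne_iff.2 ⟨i, mul_ne_zero (pow_ne_zero _ ht) hi⟩
  obtain ⟨t, i, hi⟩ := (htend.eventually hcrit.2).exists
  refine ⟨i, fun h => hi ?_⟩
  rw [eval_eq_pow_mul hm (hf.pderiv (i := i) (n' := r - w i) (by ring)), h, mul_zero]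

/-- The zero locus of the Jacobian ideal is contained in `{0}`, so the Nullstellensatz puts every `X
i` into the radical; the sum of the exponents serves all variables at once. -/
theorem exists_X_pow_mem_jacobianIdeal {w : Fin n → ℚ} (hw : ∀ i, 0 < w i) {r : ℚ}
    {f : MvPolynomial (Fin n) ℂ} (hf : IsWeightedHomogeneous w f r)
    (hcrit : HasIsolatedCriticalPoint f) : ∃ N : ℕ, ∀ i, X i ^ N ∈ jacobianIdeal f := by
  have h1 : ∀ i, X i ∈ (jacobianIdeal f).radical := by
    intro i
    rw [← vanishingIdeal_zeroLocus_eq_radical (K := ℂ), mem_vanishingIdeal_iff]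
    intro a ha
    have : a = 0 := by
      by_contra h
      obtain ⟨j, hj⟩ := exists_pderiv_ne_zero hw hf hcrit h
      refine hj ?_
      have := mem_zeroLocus_iff.1 ha (pderiv j f) (Ideal.subset_span ⟨j, rfl⟩)
      simpa [aeval_eq_eval] using this
    simp [this]
  choose N hN using h1
  refine ⟨∑ i, N i, fun i => ?_⟩
  exact Ideal.pow_mem_of_pow_mem _ (hN i)
    (Finset.single_le_sum (fun _ _ => Nat.zero_le _) (Finset.mem_univ i))

theorem monomial_mem_jacobianIdeal {f : MvPolynomial (Fin n) ℂ} {N : ℕ}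
    (hN : ∀ i, X i ^ N ∈ jacobianIdeal f) {α : Fin n →₀ ℕ} {i : Fin n} (hα : N ≤ α i) :
    monomial α (1 : ℂ) ∈ jacobianIdeal f := by
  have h : monomial α (1 : ℂ) = monomial (α - Finsupp.single i N) 1 * X i ^ N := by
    rw [X_pow_eq_monomial, monomial_mul, one_mul, tsub_add_cancel_of_le]
    simpa using hα
  rw [h]
  exact Ideal.mul_mem_left _ _ (hN i)

/-- Some `∂_i f` does not vanish at `(1, …, 1)`, hence contains a monomial `x^β`, and `β ≠ 0`
because `∂_i f` vanishes at the origin. This yields `r > 0`, and `r ≥ 2` for unit weights. -/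
theorem exists_degree_eq {w : Fin n → ℚ} {r : ℚ} (hn : 1 ≤ n) (hw : ∀ i, 0 < w i)
    {f : MvPolynomial (Fin n) ℂ} (hf : IsWeightedHomogeneous w f r)
    (hcrit : HasIsolatedCriticalPoint f) :
    ∃ (i : Fin n) (β : Fin n →₀ ℕ), β ≠ 0 ∧ r = Finsupp.weight w β + w i := by
  have ha : (fun _ => 1 : Fin n → ℂ) ≠ 0 := Function.ne_iff.2 ⟨⟨0, hn⟩, one_ne_zero⟩
  obtain ⟨i, hi⟩ := exists_pderiv_ne_zero hw hf hcrit ha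
  have hne : pderiv i f ≠ 0 := by
    rintro h
    simp [h] at hi
  obtain ⟨β, hβ⟩ := MvPolynomial.ne_zero_iff.1 hne
  refine ⟨i, β, ?_, ?_⟩
  · rintro rfl
    have := hcrit.1 i
    rw [← constantCoeff_eq] at hβ
    exact hβ (by rw [← this, ← eval_zero])
  · rw [(hf.pderiv (i := i) (n' := r - w i) (by ring)) hβ]
    ring

/-! ### Monomial bases -/

theorem relativeForms_mk_eq_mk {f : MvPolynomial (Fin n) ℂ} (μ ν : forms n (Fin n) n) :
    (Submodule.Quotient.mk μ : RelativeForms f) = Submodule.Quotient.mk ν ↔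
      ∃ η ∈ forms n (Fin n) (n - 1), (μ : DForm n (Fin n)) = ν + wedgeD id f η := by
  rw [Submodule.Quotient.eq, Submodule.submoduleOf, Submodule.mem_comap, Submodule.mem_map]
  refine exists_congr fun η => and_congr_right fun _ => ?_
  have : wedgeLeft (extD id (ofFun f)) η = wedgeD id f η := wedge_extD_ofFun _ _ _
  rw [this]
  simp only [Submodule.coe_subtype, Submodule.coe_sub]
  rw [eq_sub_iff_add_eq, add_comm, eq_comm]

theorem eq_sum_topMonomial {μ : DForm n (Fin n)} (hμ : μ ∈ forms n (Fin n) n) :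
    μ = ∑ α ∈ (μ Finset.univ).support, (μ Finset.univ).coeff α • topMonomial α := by
  funext s
  rw [Finset.sum_apply]
  by_cases hs : s = Finset.univ
  · subst hs
    conv_lhs => rw [(μ Finset.univ).as_sum]
    refine Finset.sum_congr rfl fun α _ => ?_
    simp [topMonomial, smul_monomial]
  · have : μ s = 0 := by
      rw [eq_single_univ hμ, Pi.single_eq_of_ne hs]
    simp [this, topMonomial, hs]

theorem sum_smul_relativeForms_mk (f : MvPolynomial (Fin n) ℂ) {ι : Type*} (t : Finset ι)
    (c : ι → ℂ) (φ : ι → Fin n →₀ ℕ) :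
    ∑ i ∈ t, c i • (Submodule.Quotient.mk ⟨topMonomial (φ i), topMonomial_mem (φ i)⟩ :
      RelativeForms f) =
    Submodule.Quotient.mk (∑ i ∈ t, c i • ⟨topMonomial (φ i), topMonomial_mem (φ i)⟩) := by
  rw [← Submodule.mkQ_apply, map_sum]
  simp only [map_smul]
  rfl

theorem IsMonomialBasis.exists_division {f : MvPolynomial (Fin n) ℂ} {l : ℕ}
    {φ : Fin l → Fin n →₀ ℕ} (h : IsMonomialBasis f φ) {μ : DForm n (Fin n)}
    (hμ : μ ∈ forms n (Fin n) n) : ∃ (c : Fin l → ℂ) (η : DForm n (Fin n)),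
      η ∈ forms n (Fin n) (n - 1) ∧ μ = ∑ i, c i • topMonomial (φ i) + wedgeD id f η := by
  obtain ⟨b, hb⟩ := h
  have h1 := b.sum_repr (Submodule.Quotient.mk ⟨μ, hμ⟩)
  simp only [hb] at h1
  rw [sum_smul_relativeForms_mk] at h1
  obtain ⟨η, h2, h3⟩ := (relativeForms_mk_eq_mk _ _).1 h1.symm
  refine ⟨fun i => b.repr (Submodule.Quotient.mk ⟨μ, hμ⟩) i, η, h2, ?_⟩
  simpa using h3

theorem IsMonomialBasis.eq_zero {f : MvPolynomial (Fin n) ℂ} {l : ℕ}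
    {φ : Fin l → Fin n →₀ ℕ} (h : IsMonomialBasis f φ) {c : Fin l → ℂ} {η : DForm n (Fin n)}
    (hη : η ∈ forms n (Fin n) (n - 1)) (hc : ∑ i, c i • topMonomial (φ i) = wedgeD id f η) :
    c = 0 := by
  obtain ⟨b, hb⟩ := h
  have h1 : ∑ i, c i • b i = 0 := by
    simp only [hb]
    rw [sum_smul_relativeForms_mk, ← Submodule.Quotient.mk_zero, relativeForms_mk_eq_mk]
    exact ⟨η, hη, by simpa using hc⟩
  funext i
  exact Fintype.linearIndependent_iff.1 b.linearIndependent c h1 i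

theorem IsMonomialBasis.notMem_jacobianIdeal (hn : 1 ≤ n) {f : MvPolynomial (Fin n) ℂ} {l : ℕ}
    {φ : Fin l → Fin n →₀ ℕ} (h : IsMonomialBasis f φ) (i : Fin l) :
    monomial (φ i) (1 : ℂ) ∉ jacobianIdeal f := by
  intro hi
  obtain ⟨η, h1, h2⟩ := exists_wedgeD_eq_single hn hi
  have h3 := h.eq_zero (c := Pi.single i 1) h1 (by
    rw [h2, Finset.sum_eq_single i]
    · simp [topMonomial]
    · intro j _ hj
      simp [hj]
    · simp)
  have := congrFun h3 i
  simp at this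

theorem finite_setOf_lt (n N : ℕ) : {α : Fin n →₀ ℕ | ∀ i, α i < N}.Finite := by
  refine (Set.finite_Iic (Finsupp.equivFunOnFinite.symm fun _ : Fin n => N)).subset ?_
  intro α hα i
  exact (hα i).le

/-- The classes of monomials span, so some of them form a basis. A basis class is nonzero, which
keeps all its exponents below `N` and the basis finite. -/
theorem exists_isMonomialBasis (hn : 1 ≤ n) {f : MvPolynomial (Fin n) ℂ} {N : ℕ}
    (hN : ∀ i, X i ^ N ∈ jacobianIdeal f) :
    ∃ (l : ℕ) (φ : Fin l → Fin n →₀ ℕ), IsMonomialBasis f φ := by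
  set v : (Fin n →₀ ℕ) → RelativeForms f :=
    fun α => Submodule.Quotient.mk ⟨topMonomial α, topMonomial_mem α⟩ with hv
  obtain ⟨κ, a, ha, hspan, hli⟩ := exists_linearIndependent' ℂ v
  have htop : Submodule.span ℂ (Set.range v) = ⊤ := by
    refine eq_top_iff.2 fun x _ => ?_
    obtain ⟨⟨μ, hμ⟩, rfl⟩ := Submodule.Quotient.mk_surjective _ x
    have h1 : (⟨μ, hμ⟩ : forms n (Fin n) n) = ∑ α ∈ (μ Finset.univ).support,
        (μ Finset.univ).coeff α • ⟨topMonomial α, topMonomial_mem α⟩ := by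
      apply Subtype.ext
      simpa using eq_sum_topMonomial hμ
    rw [h1, ← Submodule.mkQ_apply, map_sum]
    refine sum_mem fun α _ => ?_
    rw [map_smul]
    exact Submodule.smul_mem _ _ (Submodule.subset_span ⟨α, rfl⟩)
  have hκ : Finite κ := by
    have : ∀ x, a x ∈ {α : Fin n →₀ ℕ | ∀ i, α i < N} := by
      intro x i
      by_contra! hi
      obtain ⟨η, h1, h2⟩ := exists_wedgeD_eq_single hn (monomial_mem_jacobianIdeal hN hi)
      refine hli.ne_zero x ?_
      rw [Function.comp_apply, hv, ← Submodule.Quotient.mk_zero]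
      dsimp only
      rw [relativeForms_mk_eq_mk]
      exact ⟨η, h1, by simp [h2, topMonomial]⟩
    have hfin := (finite_setOf_lt n N).to_subtype
    exact Finite.of_injective (fun x => (⟨a x, this x⟩ : {α : Fin n →₀ ℕ | ∀ i, α i < N}))
      fun x y h => ha (congrArg Subtype.val h)
  obtain ⟨l, ⟨e⟩⟩ := Finite.exists_equiv_fin κ
  let b := (Module.Basis.mk hli (by rw [hspan, htop])).reindex e
  exact ⟨l, a ∘ e.symm, b, fun i => by simp [b, hv]⟩

/-! ### Existence of a division constant -/

theorem IsQuasihomogeneous.degreeLE {τ : Type} {v : τ → ℚ} {x : Fin n → τ} {ω : DForm n τ}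
    {d e : ℚ} (hω : IsQuasihomogeneous v x ω d) (h : d ≤ e) : DegreeLE v x ω e := by
  intro s m hm
  rw [hω s (mem_support_iff.1 hm)]
  linarith

theorem DegreeLE.sum {τ ι : Type} {v : τ → ℚ} {x : Fin n → τ} {t : Finset ι} {ω : ι → DForm n τ}
    {d : ℚ} (h : ∀ i ∈ t, DegreeLE v x (ω i) d) : DegreeLE v x (∑ i ∈ t, ω i) d := by
  classical
  intro s m hm
  rw [Finset.sum_apply] at hm
  obtain ⟨i, hi, him⟩ := Finset.mem_biUnion.1 (support_sum hm)
  exact h i hi s m him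

theorem topMonomial_add (α β : Fin n →₀ ℕ) :
    topMonomial (α + β) = (monomial α (1 : ℂ) : MvPolynomial (Fin n) ℂ) • topMonomial β := by
  funext s
  by_cases hs : s = Finset.univ
  · subst hs
    simp [topMonomial, monomial_mul]
  · simp [topMonomial, hs]

theorem formNorm_topMonomial (α : Fin n →₀ ℕ) : formNorm (topMonomial α) = 1 := by
  simp [topMonomial]

/-- Finitely many monomials have all exponents below `N`. Any other is a multiple of some `x_i^N`,
and multiplying a division of `x_i^N` by a monomial does not enlarge the norm; hence one constant
serves all monomials. -/
theorem exists_uniform_division (hn : 1 ≤ n) {w : Fin n → ℚ} {r : ℚ}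
    {f : MvPolynomial (Fin n) ℂ} (hf : IsWeightedHomogeneous w f r) {N : ℕ}
    (hN : ∀ i, X i ^ N ∈ jacobianIdeal f) {l : ℕ} {φ : Fin l → Fin n →₀ ℕ}
    (h : IsMonomialBasis f φ) : ∃ M : ℝ, ∀ α, ∃ (c : Fin l → ℂ) (η : DForm n (Fin n)),
      η ∈ forms n (Fin n) (n - 1) ∧ IsQuasihomogeneous w id η (topDegree w α - r) ∧
      topMonomial α = ∑ i, c i • topMonomial (φ i) + wedgeD id f η ∧
      formNorm η + ∑ i, ‖c i‖ ≤ M := by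
  have h1 : ∀ α, ∃ (c : Fin l → ℂ) (η : DForm n (Fin n)),
      η ∈ forms n (Fin n) (n - 1) ∧ IsQuasihomogeneous w id η (topDegree w α - r) ∧
      topMonomial α = ∑ i, c i • topMonomial (φ i) + wedgeD id f η := by
    intro α
    obtain ⟨c, η, hη, hdiv⟩ := h.exists_division (topMonomial_mem α)
    obtain ⟨c', η', h4, h5, h6, -⟩ := exists_quasihomogeneous_division hf φ
      (isQuasihomogeneous_topMonomial w α) hη hdiv
    exact ⟨c', η', h4, h5, h6⟩
  have h2 : ∀ i, ∃ η : DForm n (Fin n), η ∈ forms n (Fin n) (n - 1) ∧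
      IsQuasihomogeneous w id η (topDegree w (Finsupp.single i N) - r) ∧
      topMonomial (Finsupp.single i N) = wedgeD id f η := by
    intro i
    have hi : monomial (Finsupp.single i N) (1 : ℂ) ∈ jacobianIdeal f :=
      monomial_mem_jacobianIdeal hN (i := i) (by simp)
    obtain ⟨η, hη, hdiv⟩ := exists_wedgeD_eq_single hn hi
    -- The empty family (`l = 0`) is used, since `x_i^N` lies in the ideal and leaves no remainder.
    obtain ⟨c', η', h4, h5, h6, -⟩ := exists_quasihomogeneous_division hf
      (Fin.elim0 : Fin 0 → Fin n →₀ ℕ) (c := Fin.elim0)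
      (isQuasihomogeneous_topMonomial w (Finsupp.single i N)) hη (by simp [hdiv, topMonomial])
    exact ⟨η', h4, h5, by simpa using h6⟩
  choose c η hη hηhom hdiv using h1
  choose θ hθ hθhom hθdiv using h2
  set A := (finite_setOf_lt n N).toFinset with hA
  refine ⟨∑ α ∈ A, (formNorm (η α) + ∑ i, ‖c α i‖) + ∑ i, formNorm (θ i), fun α => ?_⟩
  have hpos : ∀ α, 0 ≤ formNorm (η α) + ∑ i, ‖c α i‖ := fun α =>
    add_nonneg (formNorm_nonneg _) (Finset.sum_nonneg fun _ _ => norm_nonneg _)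
  by_cases hα : ∀ i, α i < N
  · refine ⟨c α, η α, hη α, hηhom α, hdiv α, ?_⟩
    have hmem : α ∈ A := by simpa [hA] using hα
    have := Finset.single_le_sum (f := fun α => formNorm (η α) + ∑ i, ‖c α i‖)
      (fun α _ => hpos α) hmem
    exact this.trans (le_add_of_nonneg_right (Finset.sum_nonneg fun _ _ => formNorm_nonneg _))
  · push Not at hα
    obtain ⟨i, hi⟩ := hα
    have hαi : α = (α - Finsupp.single i N) + Finsupp.single i N := by
      rw [tsub_add_cancel_of_le]
      simpa using hi
    set β := α - Finsupp.single i N with hβ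
    refine ⟨0, (monomial β (1 : ℂ) : MvPolynomial (Fin n) ℂ) • θ i,
      poly_smul_mem_forms _ (hθ i), ?_, ?_, ?_⟩
    · have := (hθhom i).poly_smul (isWeightedHomogeneous_monomial w β (1 : ℂ) rfl)
      convert this using 1
      rw [hαi, topDegree, topDegree, map_add]
      ring
    · rw [hαi, topMonomial_add, hθdiv, map_smul]
      simp
    · have h3 : formNorm ((monomial β (1 : ℂ) : MvPolynomial (Fin n) ℂ) • θ i) ≤
          formNorm (θ i) := by
        refine (formNorm_poly_smul_le _ _).trans_eq ?_
        simp
      have h4 := Finset.single_le_sum (f := fun i => formNorm (θ i))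
        (fun i _ => formNorm_nonneg _) (Finset.mem_univ i)
      have h5 : 0 ≤ ∑ α ∈ A, (formNorm (η α) + ∑ i, ‖c α i‖) :=
        Finset.sum_nonneg fun α _ => hpos α
      simp only [Pi.zero_apply, norm_zero, Finset.sum_const_zero, add_zero]
      linarith [h3.trans h4]

/-- Divide monomial by monomial and extend linearly; for an `ℓ¹` norm the constant for monomials is
a constant for all forms. -/
theorem IsMonomialBasis.exists_isDivisionConstant (hn : 1 ≤ n) {w : Fin n → ℚ} {r : ℚ}
    {f : MvPolynomial (Fin n) ℂ} (hf : IsWeightedHomogeneous w f r) {N : ℕ}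
    (hN : ∀ i, X i ^ N ∈ jacobianIdeal f) {l : ℕ} {φ : Fin l → Fin n →₀ ℕ}
    (h : IsMonomialBasis f φ) : ∃ M : ℝ, IsDivisionConstant w r f φ M := by
  obtain ⟨M, hM⟩ := exists_uniform_division hn hf hN h
  choose c η hη hηhom hdiv hnorm using hM
  refine ⟨M, fun μ hμ => ?_⟩
  set T := (μ Finset.univ).support with hT
  refine ⟨∑ α ∈ T, (μ Finset.univ).coeff α • c α, ∑ α ∈ T, (μ Finset.univ).coeff α • η α,
    sum_mem fun α _ => Submodule.smul_mem _ _ (hη α), ?_, ?_, ?_⟩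
  · rw [wedge_extD_ofFun, map_sum]
    conv_lhs => rw [eq_sum_topMonomial hμ, ← hT]
    have h1 : ∑ i, (∑ α ∈ T, (μ Finset.univ).coeff α • c α) i • topMonomial (φ i) =
        ∑ α ∈ T, (μ Finset.univ).coeff α • ∑ i, c α i • topMonomial (φ i) := by
      simp only [Finset.sum_apply, Finset.sum_smul, Finset.smul_sum, Pi.smul_apply, smul_assoc]
      exact Finset.sum_comm
    rw [h1, ← Finset.sum_add_distrib]
    refine Finset.sum_congr rfl fun α _ => ?_
    have h2 : wedgeD id f ((μ Finset.univ).coeff α • η α) =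
        (μ Finset.univ).coeff α • wedgeD id f (η α) := LinearMap.map_smul_of_tower _ _ _
    rw [h2, ← smul_add, ← hdiv]
  · intro d hd
    refine DegreeLE.sum fun α hα => ?_
    refine ((hηhom α).smul _).degreeLE ?_
    have := hd Finset.univ α hα
    exact sub_le_sub_right this r
  · have h3 : formNorm (∑ α ∈ T, (μ Finset.univ).coeff α • η α) ≤
        ∑ α ∈ T, ‖(μ Finset.univ).coeff α‖ * formNorm (η α) := by
      refine (formNorm_sum_le _ _).trans_eq (Finset.sum_congr rfl fun α _ => formNorm_smul _ _)
    have h4 : ∑ i, ‖(∑ α ∈ T, (μ Finset.univ).coeff α • c α) i‖ ≤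
        ∑ α ∈ T, ‖(μ Finset.univ).coeff α‖ * ∑ i, ‖c α i‖ := by
      simp only [Finset.mul_sum]
      rw [Finset.sum_comm]
      refine Finset.sum_le_sum fun i _ => ?_
      rw [Finset.sum_apply]
      refine (norm_sum_le _ _).trans_eq (Finset.sum_congr rfl fun α _ => ?_)
      simp
    refine (add_le_add h3 h4).trans ?_
    rw [← Finset.sum_add_distrib]
    have h5 : formNorm μ = ∑ α ∈ T, ‖(μ Finset.univ).coeff α‖ := by
      conv_lhs => rw [eq_single_univ hμ, formNorm_single]
      rfl
    rw [h5, Finset.mul_sum]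
    refine Finset.sum_le_sum fun α _ => ?_
    rw [← mul_add, mul_comm M]
    exact mul_le_mul_of_nonneg_left (hnorm α) (norm_nonneg _)

/-! ### The division modulus is attained -/

/-- As `N` dominates the norm, all near-minimisers lie in the compact ball of radius `a + 1`, where
`N` attains its minimum on `S`. -/
theorem exists_mem_le_of_isClosed {V : Type*} [NormedAddCommGroup V] [ProperSpace V]
    {S : Set V} (hS : IsClosed S) {N : V → ℝ} (hN : Continuous N) (hNle : ∀ z, ‖z‖ ≤ N z) {a : ℝ}
    (h : ∀ ε > 0, ∃ z ∈ S, N z ≤ a + ε) : ∃ z ∈ S, N z ≤ a := by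
  have hK : IsCompact (Metric.closedBall 0 (a + 1) ∩ S) :=
    (isCompact_closedBall (0 : V) (a + 1)).inter_right hS
  have hmem : ∀ ε, 0 < ε → ε ≤ 1 → ∃ z ∈ Metric.closedBall 0 (a + 1) ∩ S, N z ≤ a + ε := by
    intro ε hε hε1
    obtain ⟨z, hz, hNz⟩ := h ε hε
    refine ⟨z, ⟨?_, hz⟩, hNz⟩
    rw [mem_closedBall_zero_iff]
    linarith [hNle z]
  obtain ⟨z₁, hz₁, -⟩ := hmem 1 one_pos le_rfl
  obtain ⟨z, hz, hmin⟩ := hK.exists_isMinOn ⟨z₁, hz₁⟩ hN.continuousOn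
  refine ⟨z, hz.2, le_of_forall_pos_le_add fun ε hε => ?_⟩
  obtain ⟨y, hy, hNy⟩ := hmem (min ε 1) (lt_min hε one_pos) (min_le_right _ _)
  exact (hmin hy).trans (hNy.trans (by linarith [min_le_left ε 1]))

/-- The form with prescribed coefficients at the monomials with exponents in `T`. -/
def formOfCoeffs (T : Finset (Fin n →₀ ℕ)) :
    (Finset (Fin n) → T → ℂ) →ₗ[ℂ] DForm n (Fin n) where
  toFun y := fun s => ∑ m : T, monomial m.1 (y s m)
  map_add' a b := by
    funext s
    simp [Finset.sum_add_distrib]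
  map_smul' c a := by
    funext s
    simp [Finset.smul_sum, smul_monomial]

theorem coeff_formOfCoeffs (T : Finset (Fin n →₀ ℕ)) (y : Finset (Fin n) → T → ℂ)
    (s : Finset (Fin n)) (m : Fin n →₀ ℕ) :
    (formOfCoeffs T y s).coeff m = if h : m ∈ T then y s ⟨m, h⟩ else 0 := by
  classical
  have : formOfCoeffs T y s = ∑ m : T, monomial m.1 (y s m) := rfl
  rw [this, coeff_sum]
  simp only [coeff_monomial]
  split_ifs with h
  · rw [Finset.sum_eq_single ⟨m, h⟩]
    · simp
    · intro b _ hb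
      rw [if_neg fun h' => hb (Subtype.ext h')]
    · simp
  · refine Finset.sum_eq_zero fun b _ => if_neg ?_
    rintro rfl
    exact h b.2

theorem formNorm_formOfCoeffs (T : Finset (Fin n →₀ ℕ)) (y : Finset (Fin n) → T → ℂ) :
    formNorm (formOfCoeffs T y) = ∑ s, ∑ m, ‖y s m‖ := by
  refine Finset.sum_congr rfl fun s _ => ?_
  rw [polyNorm_eq_sum (T := T), ← Finset.sum_coe_sort]
  · refine Finset.sum_congr rfl fun m _ => ?_
    rw [coeff_formOfCoeffs, dif_pos m.2]
  · intro m hm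
    rw [mem_support_iff, coeff_formOfCoeffs] at hm
    by_contra h
    simp [h] at hm

theorem exists_least_degree {w : Fin n → ℚ} {μ : DForm n (Fin n)} (hμ : μ ≠ 0) :
    ∃ d₀, DegreeLE w id μ d₀ ∧ ∀ d, DegreeLE w id μ d → d₀ ≤ d := by
  classical
  set T : Finset (Finset (Fin n) × (Fin n →₀ ℕ)) :=
    Finset.univ.biUnion fun s => (μ s).support.image fun m => (s, m) with hT
  have hTmem : ∀ s m, (s, m) ∈ T ↔ m ∈ (μ s).support := by
    intro s m
    simp [hT]
  obtain ⟨s, hs⟩ := Function.ne_iff.1 hμ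
  obtain ⟨α, hα⟩ := MvPolynomial.ne_zero_iff.1 hs
  obtain ⟨⟨t, m⟩, htm, hmax⟩ := T.exists_max_image
    (fun p => Finsupp.weight w p.2 + ∑ i ∈ p.1, w (id i))
    ⟨(s, α), (hTmem s α).2 (mem_support_iff.2 hα)⟩
  refine ⟨Finsupp.weight w m + ∑ i ∈ t, w (id i), ?_, ?_⟩
  · intro s' m' hm'
    exact hmax (s', m') ((hTmem s' m').2 hm')
  · intro d hd
    exact hd t m ((hTmem t m).1 htm)

/-- For fixed `μ` the degree condition confines `η` to a finite-dimensional space, in which the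
admissible pairs `(c, η)` form a closed set. A limit of division constants therefore still has a
division attaining it. -/
theorem isClosed_setOf_isDivisionConstant {w : Fin n → ℚ} (hw : ∀ i, 0 < w i) (r : ℚ)
    (f : MvPolynomial (Fin n) ℂ) {l : ℕ} (φ : Fin l → Fin n →₀ ℕ) :
    IsClosed {M : ℝ | IsDivisionConstant w r f φ M} := by
  refine isClosed_of_closure_subset fun M hM μ hμ => ?_
  by_cases hμ0 : μ = 0
  · subst hμ0
    refine ⟨0, 0, zero_mem _, ?_, ?_, by simp⟩
    · rw [wedge_extD_ofFun]
      simp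
    · intro d _ s m hm
      simp at hm
  obtain ⟨d₀, hd₀, hd₀'⟩ := exists_least_degree (w := w) hμ0
  -- The summand `1` makes the strict inequality of `finite_param` include weight `d₀ - r`.
  have hfin : {m : Fin n →₀ ℕ | Finsupp.weight w m < d₀ - r + 1}.Finite :=
    Set.finite_coe_iff.1 (finite_param w hw (d₀ - r + 1))
  set T := hfin.toFinset with hT
  let L : ((Fin l → ℂ) × (Finset (Fin n) → T → ℂ)) →ₗ[ℂ] DForm n (Fin n) :=
    (Fintype.linearCombination ℂ (fun i => (topMonomial (φ i) : DForm n (Fin n)))).comp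
      (LinearMap.fst ℂ _ _) +
    (((wedgeD id f).restrictScalars ℂ).comp (formOfCoeffs T)).comp (LinearMap.snd ℂ _ _)
  have hL : ∀ z, L z = ∑ i, z.1 i • topMonomial (φ i) + wedgeD id f (formOfCoeffs T z.2) := by
    intro z
    simp [L, Fintype.linearCombination_apply]
  -- The coordinates that must vanish for `η` to be an `(n-1)`-form of degree at most `d₀ - r`.
  let bad : Finset (Fin n) → T → Prop := fun s m =>
    s.card ≠ n - 1 ∨ d₀ - r < Finsupp.weight w m.1 + ∑ i ∈ s, w (id i)
  have hmemT : ∀ {η : DForm n (Fin n)}, DegreeLE w id η (d₀ - r) → ∀ s, ∀ m ∈ (η s).support,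
      m ∈ T := by
    intro η hη s m hm
    have h1 := hη s m hm
    have h2 : 0 ≤ ∑ i ∈ s, w (id i) := Finset.sum_nonneg fun i _ => (hw _).le
    rw [hT, Set.Finite.mem_toFinset, Set.mem_ofPred_eq]
    linarith
  have hclosed : IsClosed {z | L z = μ ∧ ∀ s m, bad s m → z.2 s m = 0} := by
    have h0 : IsClosed {z | L z = μ} := by
      by_cases hne : ∃ z₀, L z₀ = μ
      · obtain ⟨z₀, hz₀⟩ := hne
        have h1 := (Submodule.closed_of_finiteDimensional (LinearMap.ker L)).preimage
          (continuous_id.sub (continuous_const (y := z₀)))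
        convert h1 using 1
        ext z
        rw [Set.mem_preimage, SetLike.mem_coe, LinearMap.mem_ker, Pi.sub_apply, id, map_sub, hz₀,
          sub_eq_zero, Set.mem_ofPred_eq]
      · convert isClosed_empty
        ext z
        simp only [Set.mem_empty_iff_false, iff_false]
        exact fun h => hne ⟨z, h⟩
    have h1 : IsClosed {z : (Fin l → ℂ) × (Finset (Fin n) → T → ℂ) |
        ∀ s m, bad s m → z.2 s m = 0} := by
      have h2 : {z : (Fin l → ℂ) × (Finset (Fin n) → T → ℂ) | ∀ s m, bad s m → z.2 s m = 0} =
          ⋂ s, ⋂ m, ⋂ (_ : bad s m), {z | z.2 s m = 0} := by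
        ext z
        simp
      refine (h2 ▸ isClosed_iInter fun s => isClosed_iInter fun m => isClosed_iInter fun _ =>
        isClosed_eq (by fun_prop) continuous_const :)
    exact h0.inter h1
  let N : ((Fin l → ℂ) × (Finset (Fin n) → T → ℂ)) → ℝ := fun z =>
    ∑ s, ∑ m, ‖z.2 s m‖ + ∑ i, ‖z.1 i‖
  have hNcont : Continuous N := by fun_prop
  have hNle : ∀ z, ‖z‖ ≤ N z := by
    intro z
    have h1 : 0 ≤ ∑ i, ‖z.1 i‖ := Finset.sum_nonneg fun _ _ => norm_nonneg _
    have h2 : ∀ s, 0 ≤ ∑ m, ‖z.2 s m‖ := fun s => Finset.sum_nonneg fun _ _ => norm_nonneg _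
    have h3 : 0 ≤ ∑ s, ∑ m, ‖z.2 s m‖ := Finset.sum_nonneg fun s _ => h2 s
    refine max_le ?_ ?_
    · refine (pi_norm_le_iff_of_nonneg (add_nonneg h3 h1)).2 fun i => ?_
      have := Finset.single_le_sum (f := fun i => ‖z.1 i‖) (fun _ _ => norm_nonneg _)
        (Finset.mem_univ i)
      linarith
    · refine (pi_norm_le_iff_of_nonneg (add_nonneg h3 h1)).2 fun s => ?_
      refine (pi_norm_le_iff_of_nonneg (add_nonneg h3 h1)).2 fun m => ?_
      have h4 := Finset.single_le_sum (f := fun m => ‖z.2 s m‖) (fun _ _ => norm_nonneg _)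
        (Finset.mem_univ m)
      have h5 := Finset.single_le_sum (f := fun s => ∑ m, ‖z.2 s m‖) (fun s _ => h2 s)
        (Finset.mem_univ s)
      linarith
  have hμpos := formNorm_nonneg μ
  obtain ⟨z, ⟨hz1, hz2⟩, hz3⟩ := exists_mem_le_of_isClosed hclosed hNcont hNle
      (a := M * formNorm μ) (by
    intro ε hε
    -- The error in `M` is later multiplied by `‖μ‖`; dividing by `‖μ‖ + 1` keeps the product at
    -- most `ε`.
    obtain ⟨M', hM', hdist⟩ := Metric.mem_closure_iff.1 hM (ε / (formNorm μ + 1)) (by positivity)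
    obtain ⟨c, η, hη, hdiv, hdeg, hnorm⟩ := hM' μ hμ
    rw [wedge_extD_ofFun] at hdiv
    have hηdeg := hdeg d₀ hd₀
    have hηeq : formOfCoeffs T (fun s m => (η s).coeff m.1) = η := by
      funext s
      ext m
      rw [coeff_formOfCoeffs]
      split_ifs with h
      · rfl
      · by_contra h0
        exact h (hmemT hηdeg s m (mem_support_iff.2 (Ne.symm h0)))
    refine ⟨(c, fun s m => (η s).coeff m.1), ⟨?_, ?_⟩, ?_⟩
    · rw [hL, hηeq, ← hdiv]
    · rintro s m (h | h)
      · simp [hη s h]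
      · by_contra h0
        exact absurd (hηdeg s m.1 (mem_support_iff.2 h0)) (not_le.2 h)
    · have h1 : N (c, fun s m => (η s).coeff m.1) = formNorm η + ∑ i, ‖c i‖ := by
        rw [← hηeq, formNorm_formOfCoeffs, hηeq]
      rw [h1]
      refine hnorm.trans ?_
      have h2 : M' ≤ M + ε / (formNorm μ + 1) := by
        rw [Real.dist_eq] at hdist
        linarith [abs_lt.1 hdist]
      refine (mul_le_mul_of_nonneg_right h2 hμpos).trans ?_
      rw [add_mul]
      have h3 : ε / (formNorm μ + 1) * formNorm μ ≤ ε := by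
        rw [div_mul_eq_mul_div, div_le_iff₀ (by positivity)]
        nlinarith
      linarith)
  have hcoeff : ∀ s m, (formOfCoeffs T z.2 s).coeff m ≠ 0 →
      s.card = n - 1 ∧ Finsupp.weight w m + ∑ i ∈ s, w (id i) ≤ d₀ - r := by
    intro s m hm
    rw [coeff_formOfCoeffs] at hm
    split_ifs at hm with h
    · by_contra hbad
      refine hm (hz2 s ⟨m, h⟩ ?_)
      rw [not_and_or, not_le] at hbad
      exact hbad
    · exact absurd rfl hm
  refine ⟨z.1, formOfCoeffs T z.2, ?_, ?_, ?_, ?_⟩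
  · intro s hs
    ext m
    rw [coeff_zero]
    by_contra h
    exact hs (hcoeff s m h).1
  · rw [wedge_extD_ofFun, ← hL, hz1]
  · intro d hd s m hm
    have := (hcoeff s m (mem_support_iff.1 hm)).2
    linarith [hd₀' d hd]
  · rw [formNorm_formOfCoeffs]
    exact hz3

/-- Dividing a basis form leaves that form as remainder, with coefficient `1`. The basis is not
empty: all `∂_i f` vanish at `0`, so `1` is not in the Jacobian ideal. -/
theorem IsMonomialBasis.one_le {w : Fin n → ℚ} {r : ℚ} {f : MvPolynomial (Fin n) ℂ}
    (hcrit : HasIsolatedCriticalPoint f) {l : ℕ} {φ : Fin l → Fin n →₀ ℕ}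
    (h : IsMonomialBasis f φ) {M : ℝ} (hM : IsDivisionConstant w r f φ M) : 1 ≤ M := by
  have hl : 0 < l := by
    by_contra! hl
    obtain rfl : l = 0 := by omega
    obtain ⟨c, η, -, hdiv⟩ := h.exists_division (topMonomial_mem 0)
    have h1 : (1 : MvPolynomial (Fin n) ℂ) ∈ jacobianIdeal f := by
      have h2 := wedgeD_univ_mem f η
      simp only [Finset.univ_eq_empty, Finset.sum_empty, zero_add] at hdiv
      rw [← hdiv] at h2
      simpa [topMonomial] using h2
    have h3 : jacobianIdeal f ≤ RingHom.ker (eval (0 : Fin n → ℂ)) := by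
      rw [jacobianIdeal, Ideal.span_le]
      rintro _ ⟨i, rfl⟩
      exact hcrit.1 i
    have h4 := h3 h1
    rw [RingHom.mem_ker, map_one] at h4
    exact one_ne_zero h4
  obtain ⟨c, η, hη, hdiv, -, hnorm⟩ := hM _ (topMonomial_mem (φ ⟨0, hl⟩))
  rw [wedge_extD_ofFun] at hdiv
  have h1 := h.eq_zero (c := Pi.single ⟨0, hl⟩ 1 - c) hη (by
    simp only [Pi.sub_apply, sub_smul, Finset.sum_sub_distrib]
    rw [Finset.sum_eq_single ⟨0, hl⟩, Pi.single_eq_same, one_smul, sub_eq_iff_eq_add, add_comm]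
    · exact hdiv
    · intro j _ hj
      simp [hj]
    · simp)
  have h2 : c ⟨0, hl⟩ = 1 := by
    have := congrFun h1 ⟨0, hl⟩
    simp only [Pi.sub_apply, Pi.single_eq_same, Pi.zero_apply] at this
    exact (sub_eq_zero.1 this).symm
  rw [formNorm_topMonomial, mul_one] at hnorm
  have h3 := Finset.single_le_sum (f := fun i => ‖c i‖) (fun _ _ => norm_nonneg _)
    (Finset.mem_univ (⟨0, hl⟩ : Fin l))
  simp only [h2, norm_one] at h3
  linarith [formNorm_nonneg η]

/-- All bases have the same size and exponents below `N`, so there are finitely many. The set of all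
division constants is a finite union of closed sets, nonempty and bounded below by `1`, hence
contains its infimum. -/
theorem exists_isOptimalBasis (hn : 1 ≤ n) {w : Fin n → ℚ} (hw : ∀ i, 0 < w i) {r : ℚ}
    {f : MvPolynomial (Fin n) ℂ} (hf : IsWeightedHomogeneous w f r)
    (hcrit : HasIsolatedCriticalPoint f) :
    ∃ (l : ℕ) (φ : Fin l → Fin n →₀ ℕ), IsOptimalBasis w r f φ := by
  obtain ⟨N, hN⟩ := exists_X_pow_mem_jacobianIdeal hw hf hcrit
  obtain ⟨l, φ₀, hφ₀⟩ := exists_isMonomialBasis hn hN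
  have hl : ∀ {l' : ℕ} {φ : Fin l' → Fin n →₀ ℕ}, IsMonomialBasis f φ → l' = l := by
    rintro l' φ ⟨b, -⟩
    obtain ⟨b₀, -⟩ := hφ₀
    simpa using Fintype.card_congr (b.indexEquiv b₀)
  set P : Set (Fin l → Fin n →₀ ℕ) := {φ | IsMonomialBasis f φ} with hP
  have hPfin : P.Finite := by
    refine (Set.Finite.pi' fun _ : Fin l => finite_setOf_lt n N).subset fun φ hφ i j => ?_
    by_contra! hij
    exact hφ.notMem_jacobianIdeal hn i (monomial_mem_jacobianIdeal hN hij)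
  have hS : {M : ℝ | ∃ (l : ℕ) (φ : Fin l → Fin n →₀ ℕ),
      IsMonomialBasis f φ ∧ IsDivisionConstant w r f φ M} =
      ⋃ φ ∈ P, {M : ℝ | IsDivisionConstant w r f φ M} := by
    ext M
    simp only [Set.mem_iUnion, Set.mem_ofPred_eq, hP, exists_prop]
    constructor
    · rintro ⟨l', φ, h1, h2⟩
      obtain rfl := hl h1
      exact ⟨φ, h1, h2⟩
    · rintro ⟨φ, h1, h2⟩
      exact ⟨l, φ, h1, h2⟩
  have hclosed : IsClosed {M : ℝ | ∃ (l : ℕ) (φ : Fin l → Fin n →₀ ℕ),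
      IsMonomialBasis f φ ∧ IsDivisionConstant w r f φ M} := by
    rw [hS]
    exact hPfin.isClosed_biUnion fun φ _ => isClosed_setOf_isDivisionConstant hw r f φ
  obtain ⟨M, hM⟩ := hφ₀.exists_isDivisionConstant hn hf hN
  obtain ⟨l', φ, h1, h2⟩ := hclosed.csInf_mem ⟨M, l, φ₀, hφ₀, hM⟩
    ⟨1, by rintro M' ⟨l', φ, h1, h2⟩; exact h1.one_le hcrit h2⟩
  exact ⟨l', φ, h1, h2⟩

/-! ### Bounds -/

/-- There are at most `r^n` parameters, each contributing at most `r (n+1)`. Then `r + r^(n+1) (n+1)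
≤ r^(n+1) (n+2)`, and `n + 2 ≤ 4 (n-1) ≤ (n-1) r²`. The factor `n-1` is exposed because it is
bounded by the degree of any nonzero `(n-1)`-form. -/
theorem reductionConstant_le_of_weights_one (hn : 2 ≤ n) {w : Fin n → ℚ} (hw : ∀ i, w i = 1)
    {r : ℕ} (hr : 2 ≤ r) : reductionConstant w r ≤ (n - 1 : ℕ) * (r : ℝ) ^ (n + 3) := by
  have := finite_param w (fun i => by simp [hw i]) (r : ℚ)
  have := Fintype.ofFinite (Param w (r : ℚ))
  have hdeg : ∀ s : Param w (r : ℚ), ∑ i, s.1 i < r := by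
    intro s
    have h1 := s.2
    rw [Finsupp.weight_eq_sum] at h1
    simp only [hw, nsmul_eq_mul, mul_one] at h1
    exact_mod_cast h1
  have hcard : Fintype.card (Param w (r : ℚ)) ≤ r ^ n := by
    have hlt : ∀ (s : Param w (r : ℚ)) (i : Fin n), s.1 i < r := fun s i =>
      (Finset.single_le_sum (f := fun i => s.1 i) (fun _ _ => Nat.zero_le _)
        (Finset.mem_univ i)).trans_lt (hdeg s)
    have hinj : Function.Injective
        (fun (s : Param w (r : ℚ)) (i : Fin n) => (⟨s.1 i, hlt s i⟩ : Fin r)) := by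
      intro s t h
      apply Subtype.ext
      ext i
      simpa using congrArg Fin.val (congrFun h i)
    simpa using Fintype.card_le_of_injective _ hinj
  rw [reductionConstant, finsum_eq_sum_of_fintype]
  have h1 : ∑ s : Param w (r : ℚ), (((r : ℚ) : ℝ) + (∑ i, (s.1 i : ℝ)) * n) ≤
      (r : ℝ) ^ n * (r * (n + 1)) := by
    have h2 : ∀ s ∈ (Finset.univ : Finset (Param w (r : ℚ))),
        (((r : ℚ) : ℝ) + (∑ i, (s.1 i : ℝ)) * n) ≤ r * (n + 1) := by
      intro s _
      have : (∑ i, (s.1 i : ℝ)) ≤ r := by exact_mod_cast (hdeg s).le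
      have := mul_le_mul_of_nonneg_right this (Nat.cast_nonneg (α := ℝ) n)
      push_cast
      linarith
    refine (Finset.sum_le_card_nsmul _ _ _ h2).trans ?_
    rw [nsmul_eq_mul]
    refine mul_le_mul_of_nonneg_right ?_ (by positivity)
    exact_mod_cast hcard
  refine (add_le_add_right h1 _).trans ?_
  have hr' : (2 : ℝ) ≤ r := by exact_mod_cast hr
  have hpow : (1 : ℝ) ≤ (r : ℝ) ^ n := one_le_pow₀ (by linarith)
  obtain ⟨m, rfl⟩ : ∃ m, n = m + 2 := ⟨n - 2, by omega⟩
  have e : m + 2 - 1 = m + 1 := by omega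
  rw [e]
  push_cast
  set P := (r : ℝ) ^ (m + 2) with hP
  have h3 : (r : ℝ) ^ (m + 2 + 3) = P * (r * r ^ 2) := by
    rw [hP]
    ring
  rw [h3]
  have h4 : (r : ℝ) + P * (r * (m + 2 + 1)) ≤ P * r * (m + 4) := by nlinarith
  have h5 : (4 : ℝ) ≤ (r : ℝ) ^ 2 := by nlinarith
  have h6 : (m + 4 : ℝ) ≤ (m + 1) * r ^ 2 := by
    have : (0 : ℝ) ≤ m := Nat.cast_nonneg m
    nlinarith
  calc (r : ℝ) + P * (r * (m + 2 + 1)) ≤ P * r * (m + 4) := h4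
    _ ≤ P * r * ((m + 1) * r ^ 2) := mul_le_mul_of_nonneg_left h6 (by positivity)
    _ = (m + 1) * (P * (r * r ^ 2)) := by ring

theorem exists_pos_le (hn : 1 ≤ n) {w : Fin n → ℚ} (hw : ∀ i, 0 < w i) :
    ∃ w₀, 0 < w₀ ∧ ∀ i, w₀ ≤ w i := by
  have : Nonempty (Fin n) := ⟨⟨0, hn⟩⟩
  obtain ⟨i, -, hi⟩ := Finset.univ.exists_min_image w Finset.univ_nonempty
  exact ⟨w i, hw i, fun j => hi j (Finset.mem_univ j)⟩

/-- The representation of forms with parameters, with a bound for arbitrary weights. -/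
theorem representable_general (hn : 2 ≤ n) {w : Fin n → ℚ} (hw : ∀ i, 0 < w i)
    (hsum : ∑ i, w i = n) {q : ℕ} (hq : 0 < q) (hqw : ∀ i, ∃ m : ℕ, q * w i = m) {w₀ : ℚ}
    (hw₀ : 0 < w₀) (hw₀' : ∀ i, w₀ ≤ w i) {r : ℚ} (hr : 0 < r)
    {f : MvPolynomial (Fin n) ℂ} (hf : IsWeightedHomogeneous w f r) {l : ℕ}
    {φ : Fin l → Fin n →₀ ℕ} {ω₀ : Fin l → DForm n (Fin n)}
    (hω₀' : ∀ i, ω₀ i ∈ forms n (Fin n) (n - 1))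
    (hω₀ : ∀ i, IsQuasihomogeneous w id (ω₀ i) (topDegree w (φ i)))
    (hdω₀ : ∀ i, extD id (ω₀ i) = topMonomial (φ i))
    {M : ℝ} (hM1 : 1 ≤ M) (hM : IsDivisionConstant w r f φ M) {k : ℚ}
    (ω : DForm n (Fin n ⊕ Param w r)) (hω' : ω ∈ forms n (Fin n ⊕ Param w r) (n - 1))
    (hω : IsQuasihomogeneous (weightXL w r) Sum.inl ω k) :
    Representable w r f φ ω₀ ω k
      ((max 1 (max (k / w₀ : ℝ) (reductionConstant w r / w₀)) * M) ^ ⌊q * k⌋₊ * formNorm ω) := by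
  set K : ℝ := max 1 (max (k / w₀ : ℝ) (reductionConstant w r / w₀)) with hK
  have hK1 : 1 ≤ K := le_max_left _ _
  have hK2 : (k / w₀ : ℝ) ≤ K := (le_max_left _ _).trans (le_max_right _ _)
  have hK3 : reductionConstant w r / w₀ ≤ K := (le_max_right _ _).trans (le_max_right _ _)
  have hKM : 1 ≤ K * M := one_le_mul_of_one_le_of_one_le hK1 hM1
  have hw₀R : (0 : ℝ) < w₀ := by exact_mod_cast hw₀
  have hqR : (0 : ℝ) < q := by exact_mod_cast hq
  -- Excluding `ν = 0` allows `K * M ≤ (K * M) ^ ν` and makes `ν ≤ ⌊q * k⌋₊` imply `ν ≤ q * k`,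
  -- which could fail for negative `k`.
  have hlow : ∀ ν : ℕ, (q * ((n - 1 : ℕ) * w₀) : ℚ) ≤ ν → ν ≠ 0 := by
    rintro ν hν rfl
    have h1 : (0 : ℚ) < (n - 1 : ℕ) := by
      have : 0 < n - 1 := by omega
      exact_mod_cast this
    have h2 : (0 : ℚ) < q := by exact_mod_cast hq
    have : 0 < (q * ((n - 1 : ℕ) * w₀) : ℚ) := by positivity
    exact absurd hν (not_le.2 (by simpa using this))
  refine representable_of_isQuasihomogeneous (B := fun ν => (K * M) ^ ν) hn hw hsum hr hf hω₀' hω₀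
    hdω₀ hq hqw hw₀ hw₀' (zero_le_one.trans hM1) hM (fun ν => by positivity)
    (fun a b hab => pow_le_pow_right₀ hKM hab) ?_ ?_ ω hω' hω
  · intro ν hν hν'
    have hν0 := hlow ν hν'
    have h1 : (ν / q : ℝ) ≤ k := by
      rw [div_le_iff₀ hqR]
      have hνk := (Nat.le_floor_iff' hν0).1 hν
      rw [mul_comm]
      exact_mod_cast hνk
    calc M * (ν / q / w₀) ≤ M * K :=
          mul_le_mul_of_nonneg_left ((div_le_div_of_nonneg_right h1 hw₀R.le).trans hK2)
            (zero_le_one.trans hM1)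
      _ = K * M := mul_comm _ _
      _ ≤ (K * M) ^ ν := le_self_pow₀ hKM hν0
  · intro ν hν hν'
    obtain ⟨m, rfl⟩ := Nat.exists_eq_succ_of_ne_zero (hlow ν hν')
    rw [Nat.succ_sub_one, pow_succ, mul_comm]
    refine mul_le_mul_of_nonneg_left ?_ (by positivity)
    rw [mul_comm K]
    exact mul_le_mul_of_nonneg_left hK3 (zero_le_one.trans hM1)

/-- The representation of forms with parameters, with the bound for unit weights. -/
theorem representable_symmetric (hn : 2 ≤ n) {w : Fin n → ℚ} (hw : ∀ i, w i = 1) {r : ℕ}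
    (hr : 2 ≤ r) {f : MvPolynomial (Fin n) ℂ} (hf : IsWeightedHomogeneous w f (r : ℚ)) {l : ℕ}
    {φ : Fin l → Fin n →₀ ℕ} {ω₀ : Fin l → DForm n (Fin n)}
    (hω₀' : ∀ i, ω₀ i ∈ forms n (Fin n) (n - 1))
    (hω₀ : ∀ i, IsQuasihomogeneous w id (ω₀ i) (topDegree w (φ i)))
    (hdω₀ : ∀ i, extD id (ω₀ i) = topMonomial (φ i))
    {M : ℝ} (hM1 : 1 ≤ M) (hM : IsDivisionConstant w r f φ M) {k : ℚ}
    (ω : DForm n (Fin n ⊕ Param w r)) (hω' : ω ∈ forms n (Fin n ⊕ Param w r) (n - 1))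
    (hω : IsQuasihomogeneous (weightXL w r) Sum.inl ω k) :
    Representable w r f φ ω₀ ω k
      (((⌊k⌋₊).factorial : ℝ) * (r : ℝ) ^ (⌊k⌋₊ * (n + 3)) * M ^ ⌊k⌋₊ * formNorm ω) := by
  set B : ℕ → ℝ := fun ν => (ν.factorial : ℝ) * (r : ℝ) ^ (ν * (n + 3)) * M ^ ν with hB
  have hM0 : 0 ≤ M := zero_le_one.trans hM1
  have hr1 : (1 : ℝ) ≤ r := by exact_mod_cast (by omega : 1 ≤ r)
  have hB0 : ∀ ν, 0 ≤ B ν := fun ν => by positivity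
  have hsucc : ∀ ν, B (ν + 1) = M * ((ν + 1 : ℕ) * (r : ℝ) ^ (n + 3)) * B ν := by
    intro ν
    simp only [hB, Nat.factorial_succ]
    push_cast
    ring
  have hBmono : Monotone B := by
    refine monotone_nat_of_le_succ fun ν => ?_
    rw [hsucc]
    refine le_mul_of_one_le_left (hB0 ν) ?_
    refine one_le_mul_of_one_le_of_one_le hM1 (one_le_mul_of_one_le_of_one_le ?_ (one_le_pow₀ hr1))
    exact_mod_cast (by omega : 1 ≤ ν + 1)
  have hlow : ∀ ν : ℕ, (((1 : ℕ) : ℚ) * ((n - 1 : ℕ) * 1) : ℚ) ≤ ν → n - 1 ≤ ν := by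
    intro ν hν
    rw [Nat.cast_one, one_mul, mul_one] at hν
    exact_mod_cast hν
  have h := representable_of_isQuasihomogeneous (B := B) (q := 1) (w₀ := 1) hn
    (fun i => by simp [hw i]) (by simp [hw]) (r := r) (by exact_mod_cast (by omega : 0 < r)) hf hω₀' hω₀
    hdω₀ one_pos (fun i => ⟨1, by simp [hw i]⟩) one_pos (fun i => by simp [hw i]) hM0 hM hB0
    hBmono ?_ ?_ ω hω' hω
  · simpa using h
  · intro ν _ hν
    have hν1 : ν ≠ 0 := by
      have := hlow ν hν
      omega
    have h1 : (ν : ℝ) ≤ ν.factorial := by exact_mod_cast ν.self_le_factorial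
    have h2 : (1 : ℝ) ≤ (r : ℝ) ^ (ν * (n + 3)) := one_le_pow₀ hr1
    have h3 : M ≤ M ^ ν := le_self_pow₀ hM1 hν1
    simp only [Nat.cast_one, Rat.cast_one, div_one]
    calc M * ν = ν * 1 * M := by ring
      _ ≤ B ν := by
        simp only [hB]
        gcongr
  -- The factor `n - 1` of the reduction constant is at most `ν`, the factor by which the factorial
  -- grows.
  · intro ν _ hν
    have hν' := hlow ν hν
    obtain ⟨m, rfl⟩ := Nat.exists_eq_succ_of_ne_zero (by omega : ν ≠ 0)
    rw [Nat.succ_sub_one, Nat.succ_eq_add_one, hsucc, Rat.cast_one, div_one]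
    refine mul_le_mul_of_nonneg_right (mul_le_mul_of_nonneg_left ?_ hM0) (hB0 m)
    refine (reductionConstant_le_of_weights_one hn hw hr).trans ?_
    gcongr

end PolyForms

end

theorem mainTheorem1 (n : ℕ) (hn : 2 ≤ n) (w : Fin n → ℚ) (hw : ∀ i, 0 < w i)
    (hsum : ∑ i, w i = n) :
    -- the bound in the general case is `A r k * M(f) ^ N r k`, where `A`, `N` depend on `n`, `w` only
    ∃ (A : ℚ → ℚ → ℝ) (N : ℚ → ℚ → ℕ),
    ∀ (r : ℚ) (f : MvPolynomial (Fin n) ℂ), MvPolynomial.IsWeightedHomogeneous w f r →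
      PolyForms.HasIsolatedCriticalPoint f →
      -- optimal monomial bases exist
      (∃ (l : ℕ) (φ : Fin l → Fin n →₀ ℕ), PolyForms.IsOptimalBasis w r f φ) ∧
      -- each of them, together with quasihomogeneous primitives `ω_i`, generates
      ∀ (l : ℕ) (φ : Fin l → Fin n →₀ ℕ), PolyForms.IsOptimalBasis w r f φ →
      ∀ ω₀ : Fin l → PolyForms.DForm n (Fin n),
        (∀ i, ω₀ i ∈ PolyForms.forms n (Fin n) (n - 1) ∧
          PolyForms.IsQuasihomogeneous w id (ω₀ i) (PolyForms.topDegree w (φ i)) ∧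
          PolyForms.extD id (ω₀ i) = PolyForms.topMonomial (φ i)) →
      ∀ (k : ℚ) (ω : PolyForms.DForm n (Fin n ⊕ PolyForms.Param w r)),
        ω ∈ PolyForms.forms n (Fin n ⊕ PolyForms.Param w r) (n - 1) →
        PolyForms.IsQuasihomogeneous (PolyForms.weightXL w r) Sum.inl ω k →
      ∃ (p : Fin l → MvPolynomial (Option (PolyForms.Param w r)) ℂ)
        (ξ ξ' : PolyForms.DForm n (Fin n ⊕ PolyForms.Param w r)),
        ξ ∈ PolyForms.forms n (Fin n ⊕ PolyForms.Param w r) (n - 2) ∧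
        ξ' ∈ PolyForms.forms n (Fin n ⊕ PolyForms.Param w r) (n - 2) ∧
        ω = ∑ i, PolyForms.substF (PolyForms.generalPoly w r f) (p i) •
              PolyForms.liftForm (ω₀ i) +
            PolyForms.wedge
              (PolyForms.extD Sum.inl (PolyForms.ofFun (PolyForms.generalPoly w r f))) ξ +
            PolyForms.extD Sum.inl ξ' ∧
        (∀ i, MvPolynomial.IsWeightedHomogeneous (PolyForms.weightFL w r) (p i)
          (k - PolyForms.topDegree w (φ i))) ∧
        PolyForms.IsQuasihomogeneous (PolyForms.weightXL w r) Sum.inl ξ (k - r) ∧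
        PolyForms.IsQuasihomogeneous (PolyForms.weightXL w r) Sum.inl ξ' k ∧
        ∑ i, PolyForms.polyNorm (p i) ≤
          A r k * PolyForms.divisionModulus w r f ^ N r k * PolyForms.formNorm ω ∧
        -- the symmetric case
        ((∀ i, w i = 1) → ∀ r₀ k₀ : ℕ, r = r₀ → k = k₀ →
          ∑ i, PolyForms.polyNorm (p i) ≤
            (k₀.factorial : ℝ) * (r₀ : ℝ) ^ (k₀ * (n + 3)) *
              PolyForms.divisionModulus w r f ^ k₀ * PolyForms.formNorm ω) := by
  -- The same `p` must satisfy both bounds. For unit weights `A` and `N` are therefore read off the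
  -- explicit estimate; otherwise the symmetric clause is vacuous.
  by_cases hsym : ∀ i, w i = 1
  · refine ⟨fun r k => ((⌊k⌋₊).factorial : ℝ) * (⌊r⌋₊ : ℝ) ^ (⌊k⌋₊ * (n + 3)), fun _ k => ⌊k⌋₊,
      fun r f hf hcrit => ⟨PolyForms.exists_isOptimalBasis (by omega) hw hf hcrit, ?_⟩⟩
    intro l φ hφ ω₀ hω₀ k ω hω' hω
    have hM1 := hφ.1.one_le hcrit hφ.2
    -- With unit weights `r` is the ordinary degree `|β| + 1` of a monomial of `f`, and `β ≠ 0`.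
    obtain ⟨r, rfl, hr⟩ : ∃ r' : ℕ, r = r' ∧ 2 ≤ r' := by
      obtain ⟨i, β, hβ, hrβ⟩ := PolyForms.exists_degree_eq (by omega) hw hf hcrit
      refine ⟨∑ i, β i + 1, ?_, ?_⟩
      · rw [hrβ, Finsupp.weight_eq_sum]
        simp [hsym]
      · obtain ⟨j, hj⟩ := Finsupp.ne_iff.1 hβ
        have h1 : β j ≤ ∑ i, β i :=
          Finset.single_le_sum (fun _ _ => Nat.zero_le _) (Finset.mem_univ j)
        have h2 : β j ≠ 0 := hj
        omega
    obtain ⟨p, ξ, ξ', h1, h2, h3, h4, h5, h6, h7⟩ := PolyForms.representable_symmetric hn hsym hr hf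
      (fun i => (hω₀ i).1) (fun i => (hω₀ i).2.1) (fun i => (hω₀ i).2.2) hM1 hφ.2 ω hω' hω
    refine ⟨p, ξ, ξ', h1, h2, ?_, h4, h5, h6, ?_, ?_⟩
    · rw [PolyForms.wedge_extD_ofFun]
      exact h3
    · simpa using h7
    · intro _ r₀ k₀ hr₀ hk₀
      obtain rfl : r = r₀ := by exact_mod_cast hr₀
      subst hk₀
      simpa using h7
  · obtain ⟨q, hq, hqw⟩ := PolyForms.exists_common_denominator hw
    obtain ⟨w₀, hw₀, hw₀'⟩ := PolyForms.exists_pos_le (by omega) hw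
    refine ⟨fun r k => (max 1 (max (k / w₀ : ℝ) (PolyForms.reductionConstant w r / w₀))) ^ ⌊q * k⌋₊,
      fun _ k => ⌊q * k⌋₊,
      fun r f hf hcrit => ⟨PolyForms.exists_isOptimalBasis (by omega) hw hf hcrit, ?_⟩⟩
    intro l φ hφ ω₀ hω₀ k ω hω' hω
    have hM1 := hφ.1.one_le hcrit hφ.2
    have hr : 0 < r := by
      obtain ⟨i, β, -, hrβ⟩ := PolyForms.exists_degree_eq (by omega) hw hf hcrit
      have h1 := PolyForms.weight_nonneg hw β
      have h2 := hw i
      linarith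
    obtain ⟨p, ξ, ξ', h1, h2, h3, h4, h5, h6, h7⟩ := PolyForms.representable_general hn hw hsum hq
      hqw hw₀ hw₀' hr hf (fun i => (hω₀ i).1) (fun i => (hω₀ i).2.1) (fun i => (hω₀ i).2.2) hM1 hφ.2
      ω hω' hω
    refine ⟨p, ξ, ξ', h1, h2, ?_, h4, h5, h6, ?_, fun h => absurd h hsym⟩
    · rw [PolyForms.wedge_extD_ofFun]
      exact h3
    · rw [mul_pow] at h7
      exact h7
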